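/- Let $n\ge 1$ and let $\Omega\subset\mathbb{R}^n$ be a bounded open set with Lipschitz boundary. Put $$A_0=\{u\in BV(\mathbb{R}^n):\ u=0 \text{ a.e. in } \Omega^c\}.$$ There is a constant $C>0$, depending only on $\Omega$, with the following property. Let $a:\overline{\Omega}\to\mathbb{R}$ be bounded and lower semicontinuous (for example continuous) with $a\ge\alpha$ on $\overline\Omega$ for some constant $\alpha>0$, let $F\in L^1(\Omega;\mathbb{R}^n)$, and let $H\in L^\infty(\Omega)$ satisfy $$\|H\|_{L^\infty(\Omega)}<C\,\alpha .$$ Then the relaxed Dirichlet functional $$I(u)=\int_\Omega \big(a\,|Du+F|+Hu\,dx\big)+\int_{\partial\Omega}a\,|u|\,ds$$ attains its minimum over $A_0$: there is $u\in A_0$ with $I(u)\le I(v)$ for all $v\in A_0$. In the first integral $|Du+F|$ is the total variation measure of the vector measure $Du+F\,dx$ on $\Omega$. In the boundary integral $u$ denotes the inner trace of $u$ on $\partial\Omega$, that is, the function $g\in L^1(\partial\Omega)$ with $\int_\Omega u\nabla\varphi\,dx+\int_\Omega\varphi\,dDu=\int_{\partial\Omega}\varphi\,g\,\nu\,ds$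 for all $\varphi\in C^1_c(\mathbb{R}^n)$, where $\nu$ is the outer unit normal and $ds$ is the $(n-1)$-dimensional Hausdorff measure. In particular, if $a\ge 1$, then $\|H\|_{L^\infty(\Omega)}<C$ suffices. -/

import Mathlib

open MeasureTheory Set Topology
open scoped RealInnerProductSpace NNReal

noncomputable section

namespace RelaxedDirichlet

variable {n : ℕ}

/-- The vector measure `D` is the distributional derivative of `u` on `ℝⁿ` and has finite total
variation: `∫ u ∇φ dx = - ∫ φ dD` for all compactly supported `C¹` functions `φ`. -/
def IsDerivMeasure (u : EuclideanSpace ℝ (Fin n) → ℝ)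
    (D : VectorMeasure (EuclideanSpace ℝ (Fin n)) (EuclideanSpace ℝ (Fin n))) : Prop :=
  IsFiniteMeasure D.variation ∧
    ∀ φ : EuclideanSpace ℝ (Fin n) → ℝ, ContDiff ℝ 1 φ → HasCompactSupport φ →
      ∫ x, u x • gradient φ x = - D.integral φ (ContinuousLinearMap.lsmul ℝ ℝ)

/-- `u ∈ BV(ℝⁿ)`. -/
def IsBV (u : EuclideanSpace ℝ (Fin n) → ℝ) : Prop :=
  Integrable u ∧ ∃ D, IsDerivMeasure u D

open Classical in
/-- The derivative `Du` of a function of bounded variation, a finite `ℝⁿ`-valued measure (unique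
when it exists). -/
def bvDeriv (u : EuclideanSpace ℝ (Fin n) → ℝ) :
    VectorMeasure (EuclideanSpace ℝ (Fin n)) (EuclideanSpace ℝ (Fin n)) :=
  if h : ∃ D, IsDerivMeasure u D then h.choose else 0

/-- The class `A₀` of functions in `BV(ℝⁿ)` that vanish a.e. outside `Ω`. -/
def A0 (Ω : Set (EuclideanSpace ℝ (Fin n))) : Set (EuclideanSpace ℝ (Fin n) → ℝ) :=
  {u | IsBV u ∧ ∀ᵐ x, x ∉ Ω → u x = 0}

/-- The open set `Ω` has Lipschitz boundary: near each boundary point, in a suitable direction `e`,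
it is the region strictly above the graph of a Lipschitz function of the component of `x`
orthogonal to `e`. -/
def HasLipschitzBoundary (Ω : Set (EuclideanSpace ℝ (Fin n))) : Prop :=
  ∀ x₀ ∈ frontier Ω, ∃ e : EuclideanSpace ℝ (Fin n), ‖e‖ = 1 ∧
    ∃ (K : ℝ≥0) (γ : EuclideanSpace ℝ (Fin n) → ℝ), LipschitzWith K γ ∧
      ∃ r > 0, ∀ x ∈ Metric.ball x₀ r, x ∈ Ω ↔ γ (x - ⟪e, x⟫ • e) < ⟪e, x⟫

/-- `ν` is the outer unit normal to `Ω` at `x`: near `x`, the set `Ω` contains the points that lie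
on the side of `-ν` outside every cone around the hyperplane `ν^⊥`, and none of those on the side
of `ν`. -/
def IsOuterNormal (Ω : Set (EuclideanSpace ℝ (Fin n))) (x ν : EuclideanSpace ℝ (Fin n)) : Prop :=
  ‖ν‖ = 1 ∧ ∀ ε > 0, ∃ δ > 0, ∀ y ∈ Metric.ball x δ,
    (⟪y - x, ν⟫ < -(ε * ‖y - x‖) → y ∈ Ω) ∧ (ε * ‖y - x‖ < ⟪y - x, ν⟫ → y ∉ Ω)

open Classical in
/-- The outer unit normal. By Rademacher's theorem it exists at almost every point of a Lipschitz
boundary; where it does not exist the value is `0`. -/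
def outerNormal (Ω : Set (EuclideanSpace ℝ (Fin n))) (x : EuclideanSpace ℝ (Fin n)) :
    EuclideanSpace ℝ (Fin n) :=
  if h : ∃ ν, IsOuterNormal Ω x ν then h.choose else 0

/-- `g` is the (inner) trace on `∂Ω` of `u`: `g ∈ L¹(∂Ω)` for the surface measure, which is the
`(n-1)`-dimensional Hausdorff measure normalized to agree with Lebesgue measure on `ℝⁿ⁻¹`, and
`∫_Ω u ∇φ dx + ∫_Ω φ dDu = ∫_∂Ω φ g ν ds` for all compactly supported `C¹` functions `φ` on `ℝⁿ`. -/
def IsTrace (Ω : Set (EuclideanSpace ℝ (Fin n))) (u g : EuclideanSpace ℝ (Fin n) → ℝ) : Prop :=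
  IntegrableOn g (frontier Ω) (Measure.euclideanHausdorffMeasure (n - 1)) ∧
    ∀ φ : EuclideanSpace ℝ (Fin n) → ℝ, ContDiff ℝ 1 φ → HasCompactSupport φ →
      (∫ x in Ω, u x • gradient φ x)
          + ((bvDeriv u).restrict Ω).integral φ (ContinuousLinearMap.lsmul ℝ ℝ)
        = ∫ x in frontier Ω, (φ x * g x) • outerNormal Ω x
            ∂(Measure.euclideanHausdorffMeasure (n - 1))

open Classical in
/-- The trace of `u` on `∂Ω` (unique up to surface-null sets; for a bounded `Ω` with Lipschitz
boundary, every function of bounded variation has one). -/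
def bvTrace (Ω : Set (EuclideanSpace ℝ (Fin n))) (u : EuclideanSpace ℝ (Fin n) → ℝ) :
    EuclideanSpace ℝ (Fin n) → ℝ :=
  if h : ∃ g, IsTrace Ω u g then h.choose else 0

/-- The relaxed functional `∫_Ω (a |Du + F| + H u) + ∫_∂Ω a |u| ds`, where `|Du + F|` is the total
variation of the vector measure `Du + F dx` on `Ω` and `u` on `∂Ω` is the trace. -/
def relaxedEnergy (Ω : Set (EuclideanSpace ℝ (Fin n))) (a : EuclideanSpace ℝ (Fin n) → ℝ)
    (F : EuclideanSpace ℝ (Fin n) → EuclideanSpace ℝ (Fin n))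
    (H u : EuclideanSpace ℝ (Fin n) → ℝ) : ℝ :=
  (∫ x, a x ∂((bvDeriv u).restrict Ω + (volume.restrict Ω).withDensityᵥ F).variation)
    + (∫ x in Ω, H x * u x)
    + ∫ x in frontier Ω, a x * |bvTrace Ω u x| ∂(Measure.euclideanHausdorffMeasure (n - 1))

end RelaxedDirichlet

end

/-! Extension by zero absorbs the boundary integral. For `u ∈ A0 Ω`, the part of `Du` carried by
`∂Ω` is minus the trace times the outer normal times surface measure, so `∫_∂Ω a|u| ds` is the
`a`-weighted variation of `Du` on `∂Ω`. With `b` a bounded lower semicontinuous extension of `a`,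
the functional becomes `∫ b d|Du + F dx| + ∫_Ω H u` (`relaxedEnergy_eq`), and the direct method
applies.

Coercivity: some translation `v` moves the bounded set `Ω` off itself, and translating a BV function
by `v` changes it in `L¹` by at most `‖v‖ |Du|(ℝⁿ)`. Hence `∫ |u| ≤ ‖v‖ |Du|(ℝⁿ)` on `A0 Ω`
(`HasDerivDensity.integral_abs_le`). With `C = ‖v‖⁻¹` the `H`-term is strictly dominated by `α
|Du|`.

Compactness: the `H`-term is linear, so weak `L¹` convergence is enough. The translation estimate
also makes minimizing sequences equi-integrable, which gives weak limits (`exists_weak_limit`),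
while the derivatives converge vaguely (`exists_vectorMeasure_tendsto`). All limits are taken along
an ultrafilter. The variations `|Du_k + F|` have a vague limit dominating the variation of the
limit, and integrating `b` is lower semicontinuous under vague convergence.

Boundary: near a boundary point `Ω` is `{f > 0}` with `f` Lipschitz and `f (x + t • e) = f x + t`.
Integration by parts extends to bounded Borel test functions that are Lipschitz only along one
direction (`HasDerivDensity.integral_lineDeriv`). Suitable cutoffs near `{f = 0}` then show that
`Du` does not charge surface-null subsets of `∂Ω` and is normal to `∂Ω` there
(`HasDerivDensity.boundary_structure`). The trace is minus the Radon–Nikodym density of the normal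
component. -/

noncomputable section

namespace RelaxedDirichlet

open Filter ENNReal
open scoped ContDiff

/-! ### Densities of vector measures -/

section VectorMeasures

variable {X : Type*} [MeasurableSpace X] {V : Type*} [NormedAddCommGroup V] [NormedSpace ℝ V]
  [CompleteSpace V]

/-- The integral of a scalar function against the vector measure with density `q`. -/
theorem integral_withDensityᵥ_lsmul {m : Measure X} {q : X → V} (hq : Integrable q m)
    {φ : X → ℝ} (hφm : Measurable φ) {C : ℝ} (hφ : ∀ x, |φ x| ≤ C) :
    (m.withDensityᵥ q).integral φ (ContinuousLinearMap.lsmul ℝ ℝ) = ∫ x, φ x • q x ∂m := by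
  have hvar := Measure.variation_withDensityᵥ hq
  have hfin : IsFiniteMeasure (m.withDensityᵥ q).variation := by
    rw [hvar]; exact ⟨by simpa using! hq.2⟩
  have hsimple : ∀ s : SimpleFunc X ℝ,
      (m.withDensityᵥ q).integral s (ContinuousLinearMap.lsmul ℝ ℝ) = ∫ x, s x • q x ∂m := by
    intro s
    have hb : ∃ C, ∀ x, ‖s x‖ ≤ C := s.exists_forall_norm_le
    induction s using SimpleFunc.induction with
    | @const c s hs =>
      classical
      rw [SimpleFunc.coe_piecewise]
      have h1 : s.piecewise (SimpleFunc.const X c) (SimpleFunc.const X 0)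
          = s.indicator fun _ ↦ c := by
        ext x; by_cases hx : x ∈ s <;> simp [hx]
      rw [h1, VectorMeasure.integral_indicator_const _ hs]
      · rw [withDensityᵥ_apply hq hs, ContinuousLinearMap.lsmul_apply,
          ← integral_smul, ← integral_indicator hs]
        congr 1; ext x; by_cases hx : x ∈ s <;> simp [hx]
    | @add f g hfg hf hg =>
      have hif : ∀ f : SimpleFunc X ℝ, (m.withDensityᵥ q).Integrable f := fun f ↦
        Integrable.of_bound f.aestronglyMeasurable f.exists_forall_norm_le.choose
          (ae_of_all _ f.exists_forall_norm_le.choose_spec)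
      have hiq : ∀ f : SimpleFunc X ℝ, Integrable (fun x ↦ f x • q x) m := fun f ↦
        hq.bdd_smul f.exists_forall_norm_le.choose f.aestronglyMeasurable
          (ae_of_all _ f.exists_forall_norm_le.choose_spec)
      rw [SimpleFunc.coe_add, VectorMeasure.integral_add (hif f) (hif g),
        hf f.exists_forall_norm_le, hg g.exists_forall_norm_le, ← integral_add (hiq f) (hiq g)]
      simp [add_smul]
  have hC : ∀ x, ‖φ x‖ ≤ C := hφ
  let s : ℕ → SimpleFunc X ℝ := SimpleFunc.approxOn φ hφm univ 0 (mem_univ _)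
  have hs : ∀ x, Tendsto (fun k ↦ s k x) atTop (𝓝 (φ x)) := fun x ↦
    SimpleFunc.tendsto_approxOn hφm _ (by simp)
  -- Nearest-point approximation within a set containing `0` at most doubles the norm.
  have hsb : ∀ k x, ‖s k x‖ ≤ C + C := fun k x ↦
    (SimpleFunc.norm_approxOn_zero_le hφm (mem_univ _) x k).trans (add_le_add (hC x) (hC x))
  have h2 : Tendsto (fun k ↦ ∫ x, s k x • q x ∂m) atTop (𝓝 (∫ x, φ x • q x ∂m)) := by
    refine tendsto_integral_of_dominated_convergence (fun x ↦ (C + C) * ‖q x‖) ?_ ?_ ?_ ?_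
    · exact fun k ↦ (s k).aestronglyMeasurable.smul hq.aestronglyMeasurable
    · exact hq.norm.const_mul _
    · refine fun k ↦ ae_of_all _ fun x ↦ ?_
      rw [norm_smul]; exact mul_le_mul_of_nonneg_right (hsb k x) (norm_nonneg _)
    · exact ae_of_all _ fun x ↦ (hs x).smul_const _
  have h3 : Tendsto (fun k ↦ (m.withDensityᵥ q).integral (s k) (ContinuousLinearMap.lsmul ℝ ℝ))
      atTop (𝓝 ((m.withDensityᵥ q).integral φ (ContinuousLinearMap.lsmul ℝ ℝ))) := by
    refine VectorMeasure.tendsto_integral_of_dominated_convergence (fun _ ↦ C + C) ?_ ?_ ?_ ?_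
    · exact fun k ↦ (s k).aestronglyMeasurable
    · exact integrable_const _
    · exact fun k ↦ ae_of_all _ (hsb k)
    · exact ae_of_all _ hs
  simp_rw [hsimple] at h3
  exact tendsto_nhds_unique h3 h2

/-- Polar-type decomposition of a finite Euclidean-valued measure. -/
theorem exists_withDensityᵥ_variation_eq {n : ℕ} (D : VectorMeasure X (EuclideanSpace ℝ (Fin n)))
    [IsFiniteMeasure D.variation] :
    ∃ q : X → EuclideanSpace ℝ (Fin n), Measurable q ∧ Integrable q D.variation ∧
      D.variation.withDensityᵥ q = D := by
  let b := EuclideanSpace.basisFun (Fin n) ℝ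
  let P : Fin n → EuclideanSpace ℝ (Fin n) →L[ℝ] ℝ := fun i ↦ EuclideanSpace.proj i
  let S : Fin n → SignedMeasure X := fun i ↦
    D.mapRange (P i).toLinearMap.toAddMonoidHom (P i).continuous
  have hS : ∀ i s, S i s = D s i := fun i s ↦ rfl
  have hac : ∀ i, S i ≪ᵥ D.variation.toENNRealVectorMeasure := by
    intro i
    refine VectorMeasure.AbsolutelyContinuous.mk fun s hs h0 ↦ ?_
    rw [Measure.toENNRealVectorMeasure_apply_measurable hs] at h0
    have : D s = 0 := by
      have := D.enorm_measure_le_variation s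
      rw [h0] at this
      simpa using this
    simp [hS, this]
  -- The density is assembled from the Radon–Nikodym derivatives of the coordinates, each a signed
  -- measure dominated by the variation. That it has norm one a.e. is not needed.
  refine ⟨fun x ↦ ∑ i, (S i).rnDeriv D.variation x • b i, ?_, ?_, ?_⟩
  · refine Finset.measurable_sum _ fun i _ ↦ (SignedMeasure.measurable_rnDeriv _ _).smul_const _
  · exact integrable_finsetSum _ fun i _ ↦ (SignedMeasure.integrable_rnDeriv _ _).smul_const _
  · ext1 s hs
    rw [withDensityᵥ_apply (integrable_finsetSum _ fun i _ ↦
      (SignedMeasure.integrable_rnDeriv _ _).smul_const _) hs, integral_finsetSum _ fun i _ ↦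
      ((SignedMeasure.integrable_rnDeriv _ _).smul_const _).integrableOn]
    simp_rw [integral_smul_const]
    have : ∀ i, ∫ x in s, (S i).rnDeriv D.variation x ∂D.variation = D s i := by
      intro i
      have h := SignedMeasure.withDensityᵥ_rnDeriv_eq (S i) D.variation (hac i)
      have h' := congrArg (fun T : SignedMeasure X ↦ T s) h
      rwa [withDensityᵥ_apply (SignedMeasure.integrable_rnDeriv _ _) hs] at h'
    simp_rw [this]
    have := b.sum_repr (D s)
    simpa [b] using this

end VectorMeasures

/-! ### Measures determined by smooth test functions -/

section Uniqueness

variable {E : Type*} [NormedAddCommGroup E] [NormedSpace ℝ E] [FiniteDimensional ℝ E]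
  [MeasurableSpace E] [BorelSpace E]

omit [NormedSpace ℝ E] [FiniteDimensional ℝ E] [MeasurableSpace E] [BorelSpace E] in
lemma exists_abs_le_of_hasCompactSupport {φ : E → ℝ} (hφ : Continuous φ)
    (hc : HasCompactSupport φ) : ∃ C, ∀ x, |φ x| ≤ C := by
  obtain ⟨C, hC⟩ := hc.exists_bound_of_continuous hφ
  exact ⟨C, hC⟩

omit [NormedSpace ℝ E] in
lemma integrable_of_hasCompactSupport {φ : E → ℝ} (hφ : Continuous φ)
    (hc : HasCompactSupport φ) (μ : Measure E) [IsFiniteMeasure μ] : Integrable φ μ := by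
  obtain ⟨C, hC⟩ := exists_abs_le_of_hasCompactSupport hφ hc
  exact Integrable.of_bound hφ.aestronglyMeasurable C (ae_of_all _ hC)

/-- The common core of the uniqueness results: the difference of two vector measures is written with
a density, to which the fundamental lemma of the calculus of variations applies. -/
lemma withDensityᵥ_eq_zero_of_contDiff {V : Type*} [NormedAddCommGroup V] [NormedSpace ℝ V]
    [CompleteSpace V] {m : Measure E} {q : E → V} (hq : Integrable q m)
    (h : ∀ φ : E → ℝ, ContDiff ℝ ∞ φ → HasCompactSupport φ →
      (m.withDensityᵥ q).integral φ (ContinuousLinearMap.lsmul ℝ ℝ) = 0) :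
    m.withDensityᵥ q = 0 := by
  have h0 := ae_eq_zero_of_integral_contDiff_smul_eq_zero hq.locallyIntegrable fun φ hφ hc ↦ by
    obtain ⟨C, hC⟩ := exists_abs_le_of_hasCompactSupport hφ.continuous hc
    rw [← h φ hφ hc, integral_withDensityᵥ_lsmul hq hφ.continuous.measurable hC]
  rw [WithDensityᵥEq.congr_ae (g := 0) h0, withDensityᵥ_zero]

/-- A finite Euclidean-valued measure is determined by the integrals of smooth functions. -/
theorem eq_of_integral_contDiff_eq {n : ℕ} {D D' : VectorMeasure E (EuclideanSpace ℝ (Fin n))}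
    [IsFiniteMeasure D.variation] [IsFiniteMeasure D'.variation]
    (h : ∀ φ : E → ℝ, ContDiff ℝ ∞ φ → HasCompactSupport φ →
      D.integral φ (ContinuousLinearMap.lsmul ℝ ℝ) =
        D'.integral φ (ContinuousLinearMap.lsmul ℝ ℝ)) : D = D' := by
  have : IsFiniteMeasure (D - D').variation :=
    isFiniteMeasure_of_le _ VectorMeasure.variation_sub_le
  obtain ⟨q, -, hq, hD⟩ := exists_withDensityᵥ_variation_eq (D - D')
  rw [← sub_eq_zero, ← hD]
  refine withDensityᵥ_eq_zero_of_contDiff hq fun φ hφ hc ↦ ?_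
  obtain ⟨C, hC⟩ := exists_abs_le_of_hasCompactSupport hφ.continuous hc
  have h1 := integrable_of_hasCompactSupport hφ.continuous hc D.variation
  have h2 := integrable_of_hasCompactSupport hφ.continuous hc D'.variation
  rw [hD, VectorMeasure.integral_sub_vectorMeasure h1 h2, h φ hφ hc, sub_self]

-- Reads `∫ φ (S x) k x` as an integral of `φ` against an image measure on `E`, so that integrals
-- over different spaces can be compared as signed measures on `E`.
omit [NormedAddCommGroup E] [NormedSpace ℝ E] [FiniteDimensional ℝ E] [BorelSpace E] in
lemma integral_map_withDensityᵥ_lsmul {Z : Type*} [MeasurableSpace Z] {μ : Measure Z} {S : Z → E}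
    (hS : Measurable S) {k : Z → ℝ} (hk : Integrable k μ) :
    IsFiniteMeasure ((μ.withDensityᵥ k).map S).variation ∧
      ∀ {φ : E → ℝ} (_ : Measurable φ) {C : ℝ} (_ : ∀ x, |φ x| ≤ C),
      ((μ.withDensityᵥ k).map S).integral φ (ContinuousLinearMap.lsmul ℝ ℝ)
        = ∫ x, φ (S x) * k x ∂μ := by
  have : IsFiniteMeasure (μ.withDensityᵥ k).variation := by
    rw [Measure.variation_withDensityᵥ hk]; exact ⟨by simpa using! hk.2⟩
  refine ⟨inferInstance, fun {φ} hφ {C} hC ↦ ?_⟩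
  rw [VectorMeasure.integral_map hS hφ.aestronglyMeasurable (Integrable.of_bound
    (hφ.comp hS).aestronglyMeasurable C (ae_of_all _ fun x ↦ hC _))]
  exact integral_withDensityᵥ_lsmul hk (hφ.comp hS) fun x ↦ hC _

/-- Two integrals of the form `∫ φ (T x) f x` that agree for smooth compactly supported `φ` agree
for all bounded Borel functions `φ`. -/
theorem integral_comp_mul_eq_of_contDiff {X Y : Type*} [MeasurableSpace X] [MeasurableSpace Y]
    {m : Measure X} {m' : Measure Y} {T : X → E} {T' : Y → E} (hT : Measurable T)
    (hT' : Measurable T') {f : X → ℝ} {g : Y → ℝ} (hf : Integrable f m) (hg : Integrable g m')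
    (h : ∀ φ : E → ℝ, ContDiff ℝ ∞ φ → HasCompactSupport φ →
      ∫ x, φ (T x) * f x ∂m = ∫ y, φ (T' y) * g y ∂m')
    {φ : E → ℝ} (hφ : Measurable φ) {C : ℝ} (hC : ∀ x, |φ x| ≤ C) :
    ∫ x, φ (T x) * f x ∂m = ∫ y, φ (T' y) * g y ∂m' := by
  have h1 := integral_map_withDensityᵥ_lsmul hT hf
  have h2 := integral_map_withDensityᵥ_lsmul hT' hg
  have := h1.1
  have := h2.1
  have heq : (m.withDensityᵥ f).map T = (m'.withDensityᵥ g).map T' := by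
    set κ := (m.withDensityᵥ f).map T with hκ
    set κ' := (m'.withDensityᵥ g).map T' with hκ'
    have : IsFiniteMeasure (κ - κ').variation :=
      isFiniteMeasure_of_le _ VectorMeasure.variation_sub_le
    have hac : (κ - κ') ≪ᵥ (κ - κ').variation.toENNRealVectorMeasure := by
      refine VectorMeasure.AbsolutelyContinuous.mk fun s hs h0 ↦ ?_
      rw [Measure.toENNRealVectorMeasure_apply_measurable hs] at h0
      have := (κ - κ').enorm_measure_le_variation s
      rw [h0] at this
      simpa using this
    have hrn := SignedMeasure.withDensityᵥ_rnDeriv_eq (κ - κ') _ hac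
    rw [← sub_eq_zero, ← hrn]
    refine withDensityᵥ_eq_zero_of_contDiff (SignedMeasure.integrable_rnDeriv _ _)
      fun φ hφ hc ↦ ?_
    obtain ⟨C, hC⟩ := exists_abs_le_of_hasCompactSupport hφ.continuous hc
    have i1 := integrable_of_hasCompactSupport hφ.continuous hc κ.variation
    have i2 := integrable_of_hasCompactSupport hφ.continuous hc κ'.variation
    rw [hrn, VectorMeasure.integral_sub_vectorMeasure i1 i2, hκ, hκ',
      h1.2 hφ.continuous.measurable hC, h2.2 hφ.continuous.measurable hC, h φ hφ hc, sub_self]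
  rw [← h1.2 hφ hC, ← h2.2 hφ hC, heq]

/-- Comparison of the variation of a vector measure with a finite measure by testing against
nonnegative continuous functions. -/
theorem variation_le_of_integral_le {V : Type*} [NormedAddCommGroup V] [NormedSpace ℝ V]
    [CompleteSpace V] {D : VectorMeasure E V} [IsFiniteMeasure D.variation]
    {lam : Measure E} [IsFiniteMeasure lam]
    (h : ∀ φ : E → ℝ, Continuous φ → HasCompactSupport φ → (∀ x, 0 ≤ φ x) →
      ‖D.integral φ (ContinuousLinearMap.lsmul ℝ ℝ)‖ ≤ ∫ x, φ x ∂lam) :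
    D.variation ≤ lam := by
  refine VectorMeasure.variation_le_of_forall_enorm_le fun s hs ↦ ?_
  have hi1 : ∀ (μ : Measure E) [IsFiniteMeasure μ], Integrable (s.indicator fun _ ↦ (1 : ℝ)) μ :=
    fun μ _ ↦ (integrable_const _).indicator hs
  have hreal : ‖D s‖ ≤ lam.real s := by
    refine le_of_forall_pos_le_add fun ε hε ↦ ?_
    -- Approximating in `L¹` of the sum of the two measures controls the error for both at once. The
    -- positive part of `g` is then used: it is admissible as a test function and no farther from
    -- the indicator.
    obtain ⟨g, hgc, hge, hg, hgi⟩ :=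
      (hi1 (D.variation + lam)).exists_hasCompactSupport_integral_sub_le hε
    let k : E → ℝ := fun x ↦ max (g x) 0
    have hk : Continuous k := hg.max continuous_const
    have hkc : HasCompactSupport k := hgc.comp_left (g := fun t ↦ max t 0) (by simp)
    have hki := integrable_of_hasCompactSupport hk hkc
    have hdi : ∀ (μ : Measure E) [IsFiniteMeasure μ],
        Integrable (fun x ↦ |s.indicator (fun _ ↦ (1 : ℝ)) x - k x|) μ :=
      fun μ _ ↦ ((hi1 μ).sub (hki μ)).abs
    have hpt : ∀ x, |s.indicator (fun _ ↦ (1 : ℝ)) x - k x| ≤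
        ‖s.indicator (fun _ ↦ (1 : ℝ)) x - g x‖ := by
      intro x
      have h0 : s.indicator (fun _ ↦ (1 : ℝ)) x = max (s.indicator (fun _ ↦ (1 : ℝ)) x) 0 := by
        rw [max_eq_left]; exact indicator_nonneg (fun _ _ ↦ zero_le_one) x
      rw [h0, Real.norm_eq_abs, ← h0]
      conv_lhs => rw [h0]
      exact abs_max_sub_max_le_abs _ _ _
    have hsum : ∫ x, |s.indicator (fun _ ↦ (1 : ℝ)) x - k x| ∂D.variation
        + ∫ x, |s.indicator (fun _ ↦ (1 : ℝ)) x - k x| ∂lam ≤ ε := by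
      rw [← integral_add_measure (hdi _) (hdi _)]
      exact (integral_mono (hdi _) ((hi1 _).sub hgi).norm hpt).trans hge
    have hD : D s = D.integral (s.indicator fun _ ↦ (1 : ℝ)) (ContinuousLinearMap.lsmul ℝ ℝ) := by
      rw [VectorMeasure.integral_indicator_const _ hs]; simp
    have h1 : ‖D s - D.integral k (ContinuousLinearMap.lsmul ℝ ℝ)‖
        ≤ ∫ x, |s.indicator (fun _ ↦ (1 : ℝ)) x - k x| ∂D.variation := by
      rw [hD, ← VectorMeasure.integral_sub (hi1 _) (hki _)]
      refine (VectorMeasure.norm_integral_le_integral_norm).trans ?_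
      refine (mul_le_of_le_one_left (integral_nonneg fun _ ↦ norm_nonneg _)
        ContinuousLinearMap.opNorm_lsmul_le).trans ?_
      exact le_rfl
    have h2 : ∫ x, k x ∂lam ≤ lam.real s
        + ∫ x, |s.indicator (fun _ ↦ (1 : ℝ)) x - k x| ∂lam := by
      rw [← integral_indicator_one hs, ← integral_add (f := s.indicator 1) (hi1 lam) (hdi _)]
      refine integral_mono (hki _) ((hi1 lam).add (hdi _)) fun x ↦ ?_
      have := neg_abs_le (s.indicator (fun _ ↦ (1 : ℝ)) x - k x)
      change k x ≤ s.indicator (fun _ ↦ (1 : ℝ)) x + _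
      linarith
    have h3 := h k hk hkc fun x ↦ le_max_right _ _
    have h4 := norm_le_norm_sub_add (D s) (D.integral k (ContinuousLinearMap.lsmul ℝ ℝ))
    linarith
  rw [← ofReal_norm, ← ENNReal.ofReal_toReal (measure_ne_top lam s)]
  exact ENNReal.ofReal_le_ofReal hreal

end Uniqueness

/-- The derivative of `u` is the measure with density `p` with respect to `τ`. -/
structure HasDerivDensity {n : ℕ} (u : EuclideanSpace ℝ (Fin n) → ℝ)
    (τ : Measure (EuclideanSpace ℝ (Fin n)))
    (p : EuclideanSpace ℝ (Fin n) → EuclideanSpace ℝ (Fin n)) : Prop where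
  integrable : Integrable u
  integrable_density : Integrable p τ
  integral_gradient : ∀ φ : EuclideanSpace ℝ (Fin n) → ℝ, ContDiff ℝ 1 φ → HasCompactSupport φ →
      ∫ x, u x • gradient φ x = - ∫ x, φ x • p x ∂τ

/-! ### Translation, Poincaré inequality and integration by parts -/

section Identities

variable {n : ℕ} {u : EuclideanSpace ℝ (Fin n) → ℝ}
    {τ : Measure (EuclideanSpace ℝ (Fin n))} [IsFiniteMeasure τ]
    {p : EuclideanSpace ℝ (Fin n) → EuclideanSpace ℝ (Fin n)}

local notation "E" => EuclideanSpace ℝ (Fin n)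

omit [IsFiniteMeasure τ] in
lemma HasDerivDensity.integral_fderiv (h : HasDerivDensity u τ p) {φ : E → ℝ}
    (hφ : ContDiff ℝ 1 φ) (hc : HasCompactSupport φ) (v : E) :
    ∫ x, u x * fderiv ℝ φ x v = ∫ x, φ x * (-⟪p x, v⟫) ∂τ := by
  have hcd : Continuous (fderiv ℝ φ) := hφ.continuous_fderiv (by norm_num)
  have hg : ∀ x, ⟪gradient φ x, v⟫ = fderiv ℝ φ x v := fun x ↦ by
    simp [gradient]
  have hgc : Continuous (gradient φ) :=
    (InnerProductSpace.toDual ℝ E).symm.continuous.comp hcd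
  obtain ⟨C, hC⟩ := (hc.fderiv (𝕜 := ℝ)).exists_bound_of_continuous hcd
  obtain ⟨C', hC'⟩ := exists_abs_le_of_hasCompactSupport hφ.continuous hc
  have hi1 : Integrable fun x ↦ u x • gradient φ x :=
    h.integrable.smul_bdd C hgc.aestronglyMeasurable (ae_of_all _ fun x ↦
      ((InnerProductSpace.toDual ℝ E).symm.norm_map _).trans_le (hC x))
  have hi2 : Integrable (fun x ↦ φ x • p x) τ :=
    h.integrable_density.bdd_smul C' hφ.continuous.aestronglyMeasurable (ae_of_all _ hC')
  have := congrArg (fun w ↦ ⟪v, w⟫) (h.integral_gradient φ hφ hc)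
  simp only [inner_neg_right] at this
  rw [← integral_inner hi1, ← integral_inner hi2] at this
  simp_rw [inner_smul_right, real_inner_comm _ v] at this
  simp_rw [hg] at this
  rw [this, ← integral_neg]
  simp

lemma sub_eq_integral_fderiv {φ : E → ℝ} (hφ : ContDiff ℝ 1 φ) (x v : E) :
    φ (x + v) - φ x = ∫ s in Icc (0 : ℝ) 1, fderiv ℝ φ (x + s • v) v := by
  have hcd : Continuous (fderiv ℝ φ) := hφ.continuous_fderiv (by norm_num)
  have hd : ∀ s ∈ uIcc (0 : ℝ) 1,
      HasDerivAt (fun s : ℝ ↦ φ (x + s • v)) (fderiv ℝ φ (x + s • v) v) s := fun s _ ↦ by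
    have h1 : HasDerivAt (fun s : ℝ ↦ x + s • v) v s := by
      simpa using ((hasDerivAt_id s).smul_const v).const_add x
    exact ((hφ.differentiable (by norm_num)) (x + s • v)).hasFDerivAt.comp_hasDerivAt s h1
  have := intervalIntegral.integral_eq_sub_of_hasDerivAt hd
    (Continuous.intervalIntegrable (by fun_prop) _ _)
  rw [integral_Icc_eq_integral_Ioc, ← intervalIntegral.integral_of_le zero_le_one, this]
  simp

/-- The translation identity for functions of bounded variation, valid for all bounded Borel test
functions. -/
theorem HasDerivDensity.integral_translate (h : HasDerivDensity u τ p) (v : E) {φ : E → ℝ}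
    (hφ : Measurable φ) {C : ℝ} (hC : ∀ x, |φ x| ≤ C) :
    ∫ x, φ x * (u (x - v) - u x) =
      ∫ z, φ (z.1 + z.2 • v) * (-⟪p z.1, v⟫) ∂(τ.prod (volume.restrict (Icc (0 : ℝ) 1))) := by
  have hpv : Integrable (fun x ↦ -⟪p x, v⟫) τ := (h.integrable_density.inner_const v).neg
  have hT : Measurable fun z : E × ℝ ↦ z.1 + z.2 • v := by fun_prop
  -- Both sides pair `φ` with a finite signed measure on `E`, so smooth `φ` suffice. For those, the
  -- increment of `φ` is integrated along the segment, Fubini is applied, and each translate of `φ`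
  -- is tested against `Du`.
  refine integral_comp_mul_eq_of_contDiff (T := id) measurable_id hT
    ((h.integrable.comp_sub_right v).sub h.integrable) (hpv.comp_fst _) ?_ hφ hC
  intro φ hφ hc
  replace hφ : ContDiff ℝ 1 φ := hφ.of_le (by exact_mod_cast le_top)
  have hcd : Continuous (fderiv ℝ φ) := hφ.continuous_fderiv (by norm_num)
  obtain ⟨C, hC⟩ := (hc.fderiv (𝕜 := ℝ)).exists_bound_of_continuous hcd
  obtain ⟨C', hC'⟩ := exists_abs_le_of_hasCompactSupport hφ.continuous hc
  have hi : ∀ f : E → ℝ, Integrable f → Integrable fun x ↦ φ x * f x := fun f hf ↦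
    hf.bdd_mul hφ.continuous.aestronglyMeasurable (ae_of_all _ hC')
  have hl : ∫ x, φ (id x) * (u (x - v) - u x) = ∫ x, u x * (φ (x + v) - φ x) := by
    simp only [id, mul_sub]
    rw [integral_sub (hi _ (h.integrable.comp_sub_right v)) (hi _ h.integrable),
      integral_sub _ (by simpa [mul_comm] using hi _ h.integrable),
      ← integral_add_right_eq_self _ v]
    · simp [mul_comm]
    · have := (hi _ (h.integrable.comp_sub_right v)).comp_add_right v
      simpa [mul_comm] using this
  refine hl.trans ?_
  simp_rw [sub_eq_integral_fderiv hφ, ← integral_const_mul]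
  rw [integral_integral_swap, integral_prod_symm]
  · congr 1
    ext s
    have hcs : HasCompactSupport fun x ↦ φ (x + s • v) :=
      hc.comp_homeomorph (Homeomorph.addRight (s • v))
    have := h.integral_fderiv (φ := fun x ↦ φ (x + s • v)) (by fun_prop) hcs v
    simp_rw [fderiv_comp_add_right] at this
    exact this
  · refine (hpv.comp_fst _).bdd_mul (hφ.continuous.measurable.comp hT).aestronglyMeasurable
      (ae_of_all _ fun z ↦ hC' _)
  · refine (h.integrable.comp_fst (volume.restrict (Icc (0 : ℝ) 1))).mul_bdd (c := C * ‖v‖) ?_ ?_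
    · exact Continuous.aestronglyMeasurable (by fun_prop)
    · exact ae_of_all _ fun z ↦ ((fderiv ℝ φ _).le_opNorm v).trans
        (mul_le_mul_of_nonneg_right (hC _) (norm_nonneg _))

/-- Translating a function of bounded variation changes it in `L¹` by at most the length of the
translation times the total variation. -/
theorem HasDerivDensity.abs_integral_translate_le (h : HasDerivDensity u τ p) (v : E) {φ : E → ℝ}
    (hφ : Measurable φ) {C : ℝ} (hC : ∀ x, |φ x| ≤ C) :
    |∫ x, φ x * (u (x - v) - u x)| ≤ C * ‖v‖ * ∫ x, ‖p x‖ ∂τ := by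
  have hC0 : 0 ≤ C := (abs_nonneg _).trans (hC 0)
  rw [h.integral_translate v hφ hC]
  have : ∫ z, C * ‖v‖ * ‖p z.1‖ ∂(τ.prod (volume.restrict (Icc (0 : ℝ) 1))) =
      C * ‖v‖ * ∫ x, ‖p x‖ ∂τ := by
    rw [integral_const_mul, integral_fun_fst (fun x ↦ ‖p x‖)]
    simp
  rw [← this, ← Real.norm_eq_abs]
  refine norm_integral_le_of_norm_le
    ((h.integrable_density.norm.comp_fst (volume.restrict (Icc (0 : ℝ) 1))).const_mul (C * ‖v‖))
    (ae_of_all _ fun z ↦ ?_)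
  rw [norm_mul, norm_neg, mul_assoc, mul_comm ‖v‖]
  exact mul_le_mul (hC _) (norm_inner_le_norm _ _) (norm_nonneg _) hC0

/-- Poincaré inequality for functions of bounded variation that vanish outside a set which is
displaced by the translation `v`. -/
theorem HasDerivDensity.integral_abs_le (h : HasDerivDensity u τ p) {Ω : Set E}
    (hΩ : MeasurableSet Ω) (hu : ∀ᵐ x, x ∉ Ω → u x = 0) {v : E} (hv : ∀ x ∈ Ω, x - v ∉ Ω) :
    ∫ x, |u x| ≤ ‖v‖ * ∫ x, ‖p x‖ ∂τ := by
  let w := h.integrable.aestronglyMeasurable.mk u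
  have hw : Measurable w := h.integrable.aestronglyMeasurable.stronglyMeasurable_mk.measurable
  have huw : u =ᵐ[volume] w := h.integrable.aestronglyMeasurable.ae_eq_mk
  -- With the sign of `u` on `Ω` as test function, `u (x - v) = 0` for almost every `x ∈ Ω`, so the
  -- translation pairing equals `-∫ |u|`. The Borel representative `w` makes the sign measurable.
  let φ : E → ℝ := Ω.indicator fun x ↦ SignType.sign (w x)
  have hs : Measurable fun x ↦ ((SignType.sign (w x) : SignType) : ℝ) := by
    have : (fun x ↦ ((SignType.sign (w x) : SignType) : ℝ)) =
        fun x ↦ if 0 < w x then 1 else if w x < 0 then -1 else 0 := by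
      ext x
      rcases lt_trichotomy (w x) 0 with h | h | h
      · simp [h, h.not_gt]
      · simp [h]
      · simp [h]
    rw [this]
    exact Measurable.ite (measurableSet_lt measurable_const hw) measurable_const
      (Measurable.ite (measurableSet_lt hw measurable_const) measurable_const measurable_const)
  have hφ : Measurable φ := hs.indicator hΩ
  have hC : ∀ x, |φ x| ≤ 1 := fun x ↦ by
    by_cases hx : x ∈ Ω
    · simp only [φ, indicator_of_mem hx]
      rcases SignType.sign (w x) <;> simp
    · simp [φ, hx]
  have h1 := h.abs_integral_translate_le v hφ hC
  rw [one_mul] at h1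
  refine le_trans (le_of_eq ?_) h1
  rw [← abs_neg, ← integral_neg]
  have hu' : ∀ᵐ x, x - v ∉ Ω → u (x - v) = 0 :=
    (measurePreserving_sub_right volume v).quasiMeasurePreserving.ae hu
  have : ∫ x, -(φ x * (u (x - v) - u x)) = ∫ x, |u x| := by
    refine integral_congr_ae ?_
    filter_upwards [hu, hu', huw] with x h1 h2 h3
    by_cases hx : x ∈ Ω
    · rw [h2 (hv x hx), h3]
      simp [φ, hx]
    · simp [φ, hx, h1 hx]
  rw [this, abs_of_nonneg (integral_nonneg fun _ ↦ abs_nonneg _)]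

/-- Integration by parts in the direction `v` against a bounded Borel function that is Lipschitz
along lines parallel to `v`. -/
theorem HasDerivDensity.integral_lineDeriv (h : HasDerivDensity u τ p) (v : E) {φ ψ : E → ℝ}
    (hφ : Measurable φ) {C L : ℝ} (hC : ∀ x, |φ x| ≤ C)
    (hL : ∀ x (t : ℝ), |φ (x + t • v) - φ x| ≤ L * |t|)
    (hψ : ∀ᵐ x, HasLineDerivAt ℝ φ (ψ x) x v) :
    ∫ x, u x * ψ x = - ∫ x, φ x * ⟪p x, v⟫ ∂τ := by
  let t : ℕ → ℝ := fun k ↦ 1 / ((k : ℝ) + 1)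
  have ht0 : ∀ k, 0 < t k := fun k ↦ Nat.one_div_pos_of_nat
  have ht : Tendsto t atTop (𝓝 0) := tendsto_one_div_add_atTop_nhds_zero_nat
  have hL0 : 0 ≤ L := by simpa using (abs_nonneg _).trans (hL 0 1)
  have hpv : Integrable (fun x ↦ -⟪p x, v⟫) τ := (h.integrable_density.inner_const v).neg
  have hT : ∀ k, Measurable fun z : E × ℝ ↦ z.1 + z.2 • t k • v := fun k ↦ by fun_prop
  -- The translation identity divided by `t k`. On the left difference quotients appear and only
  -- their Lebesgue-a.e. limit matters; on the right, where `τ` may be singular, only continuity of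
  -- `φ` along `v` is used.
  have hid : ∀ k, ∫ x, u x * ((t k)⁻¹ * (φ (x + t k • v) - φ x)) =
      ∫ z, φ (z.1 + z.2 • t k • v) * (-⟪p z.1, v⟫)
        ∂(τ.prod (volume.restrict (Icc (0 : ℝ) 1))) := by
    intro k
    have h1 := h.integral_translate (t k • v) hφ hC
    have hi : ∀ f : E → ℝ, Integrable f → Integrable fun x ↦ φ x * f x := fun f hf ↦
      hf.bdd_mul hφ.aestronglyMeasurable (ae_of_all _ hC)
    have hl : ∫ x, φ x * (u (x - t k • v) - u x) =
        ∫ x, u x * (φ (x + t k • v) - φ x) := by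
      simp only [mul_sub]
      rw [integral_sub (hi _ (h.integrable.comp_sub_right _)) (hi _ h.integrable),
        integral_sub _ (by simpa [mul_comm] using hi _ h.integrable),
        ← integral_add_right_eq_self _ (t k • v)]
      · simp [mul_comm]
      · have := (hi _ (h.integrable.comp_sub_right (t k • v))).comp_add_right (t k • v)
        simpa [mul_comm] using this
    rw [hl] at h1
    simp_rw [mul_left_comm (u _), integral_const_mul, h1, ← integral_const_mul]
    congr 1; ext z
    rw [inner_smul_right]
    field_simp [(ht0 k).ne']
  have hlim1 : Tendsto (fun k ↦ ∫ x, u x * ((t k)⁻¹ * (φ (x + t k • v) - φ x))) atTop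
      (𝓝 (∫ x, u x * ψ x)) := by
    refine tendsto_integral_of_dominated_convergence (fun x ↦ |u x| * L) ?_ ?_ ?_ ?_
    · intro k
      exact h.integrable.aestronglyMeasurable.mul (((hφ.comp (measurable_add_const _)).sub
        hφ).const_mul _).aestronglyMeasurable
    · exact h.integrable.abs.mul_const L
    · refine fun k ↦ ae_of_all _ fun x ↦ ?_
      rw [norm_mul, norm_mul, Real.norm_eq_abs, Real.norm_eq_abs, Real.norm_eq_abs, abs_inv,
        abs_of_pos (ht0 k)]
      refine mul_le_mul_of_nonneg_left ?_ (abs_nonneg _)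
      have := hL x (t k)
      rw [abs_of_pos (ht0 k)] at this
      rw [inv_mul_le_iff₀ (ht0 k)]
      linarith
    · filter_upwards [hψ] with x hx
      refine Tendsto.const_mul _ ?_
      have h2 := hx.tendsto_slope_zero
      have h3 : Tendsto t atTop (𝓝[≠] 0) :=
        tendsto_nhdsWithin_iff.2 ⟨ht, Eventually.of_forall fun k ↦ (ht0 k).ne'⟩
      exact h2.comp h3
  have hlim2 : Tendsto (fun k ↦ ∫ z, φ (z.1 + z.2 • t k • v) * (-⟪p z.1, v⟫)
        ∂(τ.prod (volume.restrict (Icc (0 : ℝ) 1)))) atTop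
      (𝓝 (∫ z, φ z.1 * (-⟪p z.1, v⟫) ∂(τ.prod (volume.restrict (Icc (0 : ℝ) 1))))) := by
    refine tendsto_integral_of_dominated_convergence (fun z ↦ C * |-⟪p z.1, v⟫|) ?_ ?_ ?_ ?_
    · exact fun k ↦ (hφ.comp (hT k)).aestronglyMeasurable.mul
        (hpv.comp_fst _).aestronglyMeasurable
    · exact (hpv.comp_fst _).abs.const_mul C
    · refine fun k ↦ ae_of_all _ fun z ↦ ?_
      rw [norm_mul]
      exact mul_le_mul_of_nonneg_right (hC _) (abs_nonneg _)
    · refine ae_of_all _ fun z ↦ Tendsto.mul_const _ ?_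
      rw [tendsto_iff_dist_tendsto_zero]
      refine squeeze_zero (fun _ ↦ dist_nonneg) (g := fun k ↦ L * |z.2 * t k|) (fun k ↦ ?_) ?_
      · rw [Real.dist_eq, smul_smul]; exact hL _ _
      · have := ((ht.const_mul z.2).abs).const_mul L
        simpa using this
  have := tendsto_nhds_unique (hlim1.congr hid) hlim2
  rw [this, integral_fun_fst (fun x ↦ φ x * (-⟪p x, v⟫))]
  simp [integral_neg]

end Identities

/-! ### The derivative on Lipschitz level sets -/

section LevelSets

variable {n : ℕ} {u : EuclideanSpace ℝ (Fin n) → ℝ}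
    {τ : Measure (EuclideanSpace ℝ (Fin n))} [IsFiniteMeasure τ]
    {p : EuclideanSpace ℝ (Fin n) → EuclideanSpace ℝ (Fin n)}
    {e : EuclideanSpace ℝ (Fin n)} {f : EuclideanSpace ℝ (Fin n) → ℝ}

local notation "E" => EuclideanSpace ℝ (Fin n)

/-- The derivative of a function of bounded variation does not charge, in the direction `e`,
subsets of a graph over a null set. -/
theorem HasDerivDensity.inner_eq_zero_of_null (h : HasDerivDensity u τ p) (hfm : Measurable f)
    (hf : ∀ x (t : ℝ), f (x + t • e) = f x + t) {S : Set E} (hS : MeasurableSet S)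
    (hS0 : ∀ x ∈ S, f x = 0) (hnull : volume {x | x - f x • e ∈ S} = 0) :
    ∀ᵐ x ∂τ, x ∈ S → ⟪p x, e⟫ = 0 := by
  have hpe : Integrable (fun x ↦ ⟪p x, e⟫) τ := h.integrable_density.inner_const e
  rw [← ae_restrict_iff' hS]
  refine Integrable.ae_eq_zero_of_forall_setIntegral_eq_zero hpe.restrict fun A₀ hA₀ _ ↦ ?_
  rw [Measure.restrict_restrict hA₀]
  set A := A₀ ∩ S
  have hA : MeasurableSet A := hA₀.inter hS
  let A' : Set E := {x | x - f x • e ∈ A}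
  have hA' : MeasurableSet A' := hA.preimage (by fun_prop)
  have hA'0 : volume A' = 0 := measure_mono_null (fun x hx ↦ hx.2) hnull
  have hinv : ∀ x (t : ℝ), x + t • e ∈ A' ↔ x ∈ A' := fun x t ↦ by
    have : x + t • e - f (x + t • e) • e = x - f x • e := by rw [hf, add_smul]; abel
    simp only [A', mem_ofPred_eq, this]
  -- `A'` is the cylinder over `A` in direction `e`: invariant along `e` and Lebesgue null. Hence
  -- these cutoffs are Lipschitz along `e` with zero line derivative a.e., yet they converge
  -- pointwise to the indicator of `A`, which `τ` may charge.
  let φ : ℕ → E → ℝ := fun k ↦ A'.indicator fun x ↦ max 0 (1 - k * |f x|)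
  have hφm : ∀ k, Measurable (φ k) := fun k ↦ by
    refine Measurable.indicator ?_ hA'
    have : Measurable fun x ↦ |f x| := by
      simpa only [Real.norm_eq_abs] using hfm.norm
    fun_prop
  have hφ1 : ∀ k x, |φ k x| ≤ 1 := fun k x ↦ by
    by_cases hx : x ∈ A'
    · simp only [φ, indicator_of_mem hx]
      rw [abs_of_nonneg (le_max_left _ _)]
      exact max_le zero_le_one (sub_le_self _ (by positivity))
    · simp [φ, hx]
  have hφL : ∀ k x (t : ℝ), |φ k (x + t • e) - φ k x| ≤ k * |t| := fun k x t ↦ by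
    by_cases hx : x ∈ A'
    · simp only [φ, indicator_of_mem hx, indicator_of_mem ((hinv x t).2 hx), hf]
      rw [max_comm 0, max_comm 0]
      refine (abs_max_sub_max_le_abs _ _ _).trans ?_
      have : 1 - (k : ℝ) * |f x + t| - (1 - k * |f x|) = k * (|f x| - |f x + t|) := by ring
      rw [this, abs_mul, Nat.abs_cast]
      refine mul_le_mul_of_nonneg_left ?_ (Nat.cast_nonneg _)
      refine (abs_abs_sub_abs_le_abs_sub _ _).trans ?_
      simp
    · simp only [φ, indicator_of_notMem hx, indicator_of_notMem (mt (hinv x t).1 hx)]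
      simp only [sub_self, abs_zero]
      positivity
  have hint : ∀ k, ∫ x, φ k x * ⟪p x, e⟫ ∂τ = 0 := fun k ↦ by
    have := h.integral_lineDeriv e (ψ := fun _ ↦ 0) (hφm k) (hφ1 k) (hφL k) (by
      have : ∀ᵐ x, x ∉ A' := measure_eq_zero_iff_ae_notMem.1 hA'0
      filter_upwards [this] with x hx
      have h0 : (fun t : ℝ ↦ φ k (x + t • e)) = fun _ ↦ 0 := by
        ext t; simp only [φ, indicator_of_notMem (mt (hinv x t).1 hx)]
      rw [HasLineDerivAt, h0]
      exact hasDerivAt_const _ _)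
    simpa using this
  have hlim : Tendsto (fun k ↦ ∫ x, φ k x * ⟪p x, e⟫ ∂τ) atTop
      (𝓝 (∫ x, A.indicator (fun x ↦ ⟪p x, e⟫) x ∂τ)) := by
    refine tendsto_integral_of_dominated_convergence (fun x ↦ |⟪p x, e⟫|) ?_ hpe.abs ?_ ?_
    · exact fun k ↦ (hφm k).aestronglyMeasurable.mul hpe.aestronglyMeasurable
    · refine fun k ↦ ae_of_all _ fun x ↦ ?_
      rw [norm_mul]
      exact mul_le_of_le_one_left (abs_nonneg _) (hφ1 k x)
    · refine ae_of_all _ fun x ↦ ?_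
      by_cases hx0 : f x = 0
      · have : x ∈ A' ↔ x ∈ A := by simp [A', hx0]
        by_cases hx : x ∈ A
        · simp [φ, this.2 hx, hx, hx0]
        · simp [φ, mt this.1 hx, hx]
      · have hx : x ∉ A := fun hx ↦ hx0 (hS0 x hx.2)
        rw [indicator_of_notMem hx]
        refine tendsto_const_nhds.congr' ?_
        obtain ⟨k₀, hk₀⟩ := exists_nat_gt (1 / |f x|)
        filter_upwards [eventually_ge_atTop k₀] with k hk
        have h1 : 1 - (k : ℝ) * |f x| ≤ 0 := by
          rw [div_lt_iff₀ (abs_pos.2 hx0)] at hk₀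
          have : (k₀ : ℝ) * |f x| ≤ k * |f x| :=
            mul_le_mul_of_nonneg_right (Nat.cast_le.2 hk) (abs_nonneg _)
          linarith
        by_cases hx' : x ∈ A'
        · simp [φ, hx', max_eq_left h1]
        · simp [φ, hx']
  simp_rw [hint] at hlim
  rw [← integral_indicator hA]
  exact (tendsto_nhds_unique hlim tendsto_const_nhds)

/-- The level sets of `f` are translates of one another and only countably many can have positive
measure, so none has. -/
lemma volume_zeroSet_eq_zero (hfm : Measurable f) (hf : ∀ x (t : ℝ), f (x + t • e) = f x + t) :
    volume {x | f x = 0} = 0 := by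
  have hc : {t : ℝ | 0 < volume {x | f x = t}}.Countable :=
    Measure.countable_meas_level_set_pos hfm
  obtain ⟨t, ht⟩ : ∃ t : ℝ, t ∉ {t : ℝ | 0 < volume {x | f x = t}} := by
    by_contra! hall
    exact not_countable (α := ℝ) (countable_univ_iff.1 (hc.mono fun t _ ↦ hall t))
  have : {x | f x = 0} = (fun x ↦ x + t • e) ⁻¹' {x | f x = t} := by
    ext x; simp [hf]
  rw [this, measure_preimage_add_right]
  simpa using ht

lemma fderiv_add_smul (hf : ∀ x (t : ℝ), f (x + t • e) = f x + t) (x : E) (t : ℝ) :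
    fderiv ℝ f (x + t • e) = fderiv ℝ f x := by
  have h1 : fderiv ℝ (fun y ↦ f (y + t • e)) x = fderiv ℝ f (x + t • e) :=
    fderiv_comp_add_right _
  rw [← h1]
  simp_rw [hf]
  exact fderiv_add_const _

/-- Since `∂_e f = 1`, the field `v - (∂_v f) e` is tangent to the level sets of `f`. Integrating `φ
θ(f)` by parts along `v`, and `(∂_v f) φ θ(f)` along `e`, the two terms with `θ'` cancel. The
coefficient `∂_v f` is merely Borel, but it is constant along `e`, so the second integration by
parts is legitimate. -/
lemma HasDerivDensity.integral_mul_comp_level (h : HasDerivDensity u τ p) {K : ℝ≥0}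
    (hK : LipschitzWith K f) (hf : ∀ x (t : ℝ), f (x + t • e) = f x + t) (v : E)
    {θ θ' : ℝ → ℝ} {L : ℝ} (hθ1 : ∀ s, |θ s| ≤ 1) (hθ : ∀ s, HasDerivAt θ (θ' s) s)
    (hθL : ∀ s t, |θ s - θ t| ≤ L * |s - t|) {φ : E → ℝ} (hφ : ContDiff ℝ 1 φ)
    (hc : HasCompactSupport φ) :
    ∫ x, u x * ((fderiv ℝ φ x v - fderiv ℝ f x v * fderiv ℝ φ x e) * θ (f x)) =
      - ∫ x, φ x * θ (f x) * (⟪p x, v⟫ - fderiv ℝ f x v * ⟪p x, e⟫) ∂τ := by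
  have hL0 : 0 ≤ L := by simpa using (abs_nonneg _).trans (hθL 1 0)
  have hcd : Continuous (fderiv ℝ φ) := hφ.continuous_fderiv (by norm_num)
  obtain ⟨C, hC⟩ := exists_abs_le_of_hasCompactSupport hφ.continuous hc
  obtain ⟨C', hC'⟩ := (hc.fderiv (𝕜 := ℝ)).exists_bound_of_continuous hcd
  have hC0 : 0 ≤ C := (abs_nonneg _).trans (hC 0)
  have hC'0 : 0 ≤ C' := (norm_nonneg _).trans (hC' 0)
  have hθc : Continuous θ := continuous_iff_continuousAt.2 fun s ↦ (hθ s).continuousAt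
  have hm : Measurable fun x ↦ fderiv ℝ f x v := measurable_fderiv_apply_const ℝ f v
  have hmb : ∀ x, |fderiv ℝ f x v| ≤ K * ‖v‖ := fun x ↦
    ((fderiv ℝ f x).le_opNorm v).trans
      (mul_le_mul_of_nonneg_right (norm_fderiv_le_of_lipschitz ℝ hK) (norm_nonneg _))
  have hθ'e : θ' = deriv θ := by ext s; exact (hθ s).deriv.symm
  have hθ'm : Measurable θ' := hθ'e ▸ measurable_deriv θ
  have hθ'b : ∀ s, |θ' s| ≤ L := fun s ↦ by
    have := norm_deriv_le_of_lip' (f := θ) (x₀ := s) hL0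
      (Eventually.of_forall fun t ↦ hθL t s)
    rwa [hθ'e]
  have hφL : ∀ (w x : E) (t : ℝ), |φ (x + t • w) - φ x| ≤ C' * ‖w‖ * |t| := fun w x t ↦ by
    have := Convex.norm_image_sub_le_of_norm_fderiv_le (𝕜 := ℝ) (f := φ) (s := univ)
      (x := x) (y := x + t • w) (fun y _ ↦ hφ.differentiable (by norm_num) y)
      (fun y _ ↦ hC' y) convex_univ (mem_univ _) (mem_univ _)
    rw [add_sub_cancel_left, norm_smul, Real.norm_eq_abs, Real.norm_eq_abs] at this
    linarith
  have hfL : ∀ (w x : E) (t : ℝ), |f (x + t • w) - f x| ≤ K * ‖w‖ * |t| := fun w x t ↦ by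
    have := hK.dist_le_mul (x + t • w) x
    rw [dist_eq_norm, dist_eq_norm, add_sub_cancel_left, norm_smul, Real.norm_eq_abs,
      Real.norm_eq_abs] at this
    linarith
  have hprod : ∀ (w x : E) (t : ℝ), |φ (x + t • w) * θ (f (x + t • w)) - φ x * θ (f x)| ≤
      (C' * ‖w‖ + C * (L * (K * ‖w‖))) * |t| := fun w x t ↦ by
    have h1 : φ (x + t • w) * θ (f (x + t • w)) - φ x * θ (f x) =
      (φ (x + t • w) - φ x) * θ (f (x + t • w)) + φ x * (θ (f (x + t • w)) - θ (f x)) := by ring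
    rw [h1]
    refine (abs_add_le _ _).trans ?_
    rw [abs_mul, abs_mul, add_mul]
    refine add_le_add ?_ ?_
    · exact (mul_le_of_le_one_right (abs_nonneg _) (hθ1 _)).trans (hφL w x t)
    · rw [mul_assoc, mul_assoc]
      refine mul_le_mul (hC _) ((hθL _ _).trans ?_) (abs_nonneg _) hC0
      exact mul_le_mul_of_nonneg_left (hfL w x t) hL0
  have hφθb : ∀ x, |φ x * θ (f x)| ≤ C := fun x ↦ by
    rw [abs_mul]; exact (mul_le_of_le_one_right (abs_nonneg _) (hθ1 _)).trans (hC x)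
  have hφθm : Measurable fun x ↦ φ x * θ (f x) :=
    hφ.continuous.measurable.mul (hθc.measurable.comp hK.continuous.measurable)
  have hdφ : ∀ x w, HasLineDerivAt ℝ φ (fderiv ℝ φ x w) x w := fun x w ↦
    (hφ.differentiable (by norm_num) x).hasFDerivAt.hasLineDerivAt w
  have T1 := h.integral_lineDeriv v
    (ψ := fun x ↦ fderiv ℝ φ x v * θ (f x) + φ x * (θ' (f x) * fderiv ℝ f x v))
    hφθm hφθb (hprod v) (by
      filter_upwards [hK.ae_differentiableAt] with x hx
      have h1 := hx.hasFDerivAt.hasLineDerivAt v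
      have h2 : HasDerivAt (fun t : ℝ ↦ θ (f (x + t • v))) (θ' (f x) * fderiv ℝ f x v) 0 := by
        have h3 := hθ (f (x + (0 : ℝ) • v))
        have := HasDerivAt.comp (0 : ℝ) h3 h1
        simpa [Function.comp_def] using this
      have := (hdφ x v).mul h2
      simpa [HasLineDerivAt, Pi.mul_def] using this)
  have T2 := h.integral_lineDeriv e
    (φ := fun x ↦ fderiv ℝ f x v * (φ x * θ (f x)))
    (ψ := fun x ↦ fderiv ℝ f x v * (fderiv ℝ φ x e * θ (f x) + φ x * θ' (f x)))
    (C := K * ‖v‖ * C) (L := K * ‖v‖ * (C' * ‖e‖ + C * (L * (K * ‖e‖))))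
    (hm.mul hφθm)
    (fun x ↦ by
      rw [abs_mul]
      exact mul_le_mul (hmb x) (hφθb x) (abs_nonneg _) (by positivity))
    (fun x t ↦ by
      simp only [fderiv_add_smul hf]
      rw [← mul_sub, abs_mul, mul_assoc]
      exact mul_le_mul (hmb x) (hprod e x t) (abs_nonneg _) (by positivity))
    (ae_of_all _ fun x ↦ by
      have h2 : HasDerivAt (fun t : ℝ ↦ θ (f (x + t • e))) (θ' (f x)) 0 := by
        simp_rw [hf]
        have h3 := hθ (f x + 0)
        have := HasDerivAt.comp_const_add (f x) 0 h3
        simpa using this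
      have := ((hdφ x e).mul h2).const_mul (fderiv ℝ f x v)
      simp only [HasLineDerivAt, fderiv_add_smul hf]
      simpa using this)
  have hui : ∀ {g : E → ℝ} {c : ℝ}, Measurable g → (∀ x, |g x| ≤ c) →
      Integrable fun x ↦ u x * g x := fun hg hb ↦
    h.integrable.mul_bdd hg.aestronglyMeasurable (ae_of_all _ hb)
  have hdm : ∀ w, Measurable fun x ↦ fderiv ℝ φ x w := fun w ↦
    measurable_fderiv_apply_const ℝ φ w
  have hdb : ∀ w x, |fderiv ℝ φ x w| ≤ C' * ‖w‖ := fun w x ↦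
    ((fderiv ℝ φ x).le_opNorm w).trans (mul_le_mul_of_nonneg_right (hC' x) (norm_nonneg _))
  have hθfm : Measurable fun x ↦ θ (f x) := hθc.measurable.comp hK.continuous.measurable
  have hθ'fm : Measurable fun x ↦ θ' (f x) := hθ'm.comp hK.continuous.measurable
  have hφm := hφ.continuous.measurable
  have I1 : Integrable fun x ↦
      u x * (fderiv ℝ φ x v * θ (f x) + φ x * (θ' (f x) * fderiv ℝ f x v)) := by
    refine hui (c := C' * ‖v‖ * 1 + C * (L * (K * ‖v‖)))
      (((hdm v).mul hθfm).add (hφm.mul (hθ'fm.mul hm))) fun x ↦ ?_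
    refine (abs_add_le _ _).trans ?_
    rw [abs_mul, abs_mul, abs_mul]
    gcongr
    exacts [hdb v x, hθ1 _, hC x, hθ'b _, hmb x]
  have I2 : Integrable fun x ↦
      u x * (fderiv ℝ f x v * (fderiv ℝ φ x e * θ (f x) + φ x * θ' (f x))) := by
    refine hui (c := K * ‖v‖ * (C' * ‖e‖ * 1 + C * L))
      (hm.mul (((hdm e).mul hθfm).add (hφm.mul hθ'fm))) fun x ↦ ?_
    rw [abs_mul]
    refine mul_le_mul (hmb x) ((abs_add_le _ _).trans ?_) (abs_nonneg _) (by positivity)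
    rw [abs_mul, abs_mul]
    gcongr
    exacts [hdb e x, hθ1 _, hC x, hθ'b _]
  have J1 : Integrable (fun x ↦ φ x * θ (f x) * ⟪p x, v⟫) τ :=
    (h.integrable_density.inner_const v).bdd_mul hφθm.aestronglyMeasurable (ae_of_all _ hφθb)
  have J2 : Integrable (fun x ↦ fderiv ℝ f x v * (φ x * θ (f x)) * ⟪p x, e⟫) τ := by
    refine (h.integrable_density.inner_const e).bdd_mul (c := K * ‖v‖ * C)
      (hm.mul hφθm).aestronglyMeasurable (ae_of_all _ fun x ↦ ?_)
    rw [norm_mul]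
    exact mul_le_mul (hmb x) (hφθb x) (abs_nonneg _) (by positivity)
  calc _ = (∫ x, u x * (fderiv ℝ φ x v * θ (f x) + φ x * (θ' (f x) * fderiv ℝ f x v))) -
        ∫ x, u x * (fderiv ℝ f x v * (fderiv ℝ φ x e * θ (f x) + φ x * θ' (f x))) := by
        rw [← integral_sub I1 I2]; congr 1; ext x; ring
    _ = _ := by
        rw [T1, T2, neg_sub_neg, ← neg_sub, ← integral_sub J1 J2]
        congr 2; ext x; ring

/-- On a Lipschitz level set, the derivative of a function of bounded variation is normal to the
level set. -/
theorem HasDerivDensity.inner_eq_on_zeroSet (h : HasDerivDensity u τ p) {K : ℝ≥0}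
    (hK : LipschitzWith K f) (hf : ∀ x (t : ℝ), f (x + t • e) = f x + t) (v : E) :
    ∀ᵐ x ∂τ, f x = 0 → ⟪p x, v⟫ = fderiv ℝ f x v * ⟪p x, e⟫ := by
  -- Smooth, globally Lipschitz kernels decreasing to the indicator of `{0}`. Composed with `f` they
  -- concentrate on the zero set, which is Lebesgue null: the volume integral vanishes in the limit
  -- and only the part of `τ` on the zero set survives.
  let θ : ℕ → ℝ → ℝ := fun k s ↦ (1 + (k + 1) * s ^ 2)⁻¹
  have hpos : ∀ (k : ℕ) (s : ℝ), 0 < 1 + ((k : ℝ) + 1) * s ^ 2 := fun k s ↦ by positivity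
  have hθ1 : ∀ k s, |θ k s| ≤ 1 := fun k s ↦ by
    rw [abs_of_nonneg (inv_nonneg.2 (hpos k s).le)]
    exact inv_le_one_of_one_le₀ (le_add_of_nonneg_right (by positivity))
  have hθd : ∀ k s, HasDerivAt (θ k) (-(((k : ℝ) + 1) * (2 * s)) /
      (1 + (k + 1) * s ^ 2) ^ 2) s := fun k s ↦ by
    have h1 : HasDerivAt (fun s : ℝ ↦ 1 + ((k : ℝ) + 1) * s ^ 2) (((k : ℝ) + 1) * (2 * s)) s := by
      simpa using ((hasDerivAt_pow 2 s).const_mul ((k : ℝ) + 1)).const_add 1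
    exact h1.inv (hpos k s).ne'
  have hθL : ∀ (k : ℕ) s t, |θ k s - θ k t| ≤ 2 * ((k : ℝ) + 1) * |s - t| := fun k s t ↦ by
    have h1 : θ k s - θ k t = (((k : ℝ) + 1) * (t - s)) * ((s * θ k s) * θ k t
        + (t * θ k t) * θ k s) := by
      simp only [θ]
      field_simp [(hpos k s).ne', (hpos k t).ne']
      ring
    have h2 : ∀ s, |s * θ k s| ≤ 1 := fun s ↦ by
      rw [abs_mul, abs_of_nonneg (inv_nonneg.2 (hpos k s).le), ← div_eq_mul_inv,
        div_le_one (hpos k s)]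
      have := sq_abs s
      have hk : (0 : ℝ) ≤ k := Nat.cast_nonneg k
      nlinarith [sq_nonneg (|s| - 1), abs_nonneg s, mul_nonneg hk (sq_nonneg s)]
    rw [h1, abs_mul, abs_mul, abs_sub_comm t s, abs_of_nonneg (by positivity : (0:ℝ) ≤ k + 1)]
    have h3 : |s * θ k s * θ k t + t * θ k t * θ k s| ≤ 2 := by
      refine (abs_add_le _ _).trans ?_
      rw [abs_mul, abs_mul (t * _)]
      have := mul_le_one₀ (h2 s) (abs_nonneg _) (hθ1 k t)
      have := mul_le_one₀ (h2 t) (abs_nonneg _) (hθ1 k s)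
      linarith
    nlinarith [mul_nonneg (by positivity : (0:ℝ) ≤ k + 1) (abs_nonneg (s - t))]
  have hθlim : ∀ s, Tendsto (fun k ↦ θ k s) atTop (𝓝 (({0} : Set ℝ).indicator 1 s)) := fun s ↦ by
    by_cases hs : s = 0
    · simp [θ, hs]
    · rw [indicator_of_notMem (by simpa using hs)]
      refine Tendsto.inv_tendsto_atTop ?_
      refine tendsto_atTop_add_const_left _ _ ?_
      refine Tendsto.atTop_mul_const (by positivity) ?_
      exact tendsto_atTop_add_const_right _ _ tendsto_natCast_atTop_atTop
  have hfm := hK.continuous.measurable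
  have hZ : MeasurableSet {x | f x = 0} := hfm (measurableSet_singleton 0)
  have hZ0 := volume_zeroSet_eq_zero hfm hf
  have hm : Measurable fun x ↦ fderiv ℝ f x v := measurable_fderiv_apply_const ℝ f v
  have hmb : ∀ x, |fderiv ℝ f x v| ≤ K * ‖v‖ := fun x ↦
    ((fderiv ℝ f x).le_opNorm v).trans
      (mul_le_mul_of_nonneg_right (norm_fderiv_le_of_lipschitz ℝ hK) (norm_nonneg _))
  let q : E → ℝ := fun x ↦ ⟪p x, v⟫ - fderiv ℝ f x v * ⟪p x, e⟫
  have hq : Integrable q τ := (h.integrable_density.inner_const v).sub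
    ((h.integrable_density.inner_const e).bdd_mul hm.aestronglyMeasurable (ae_of_all _ hmb))
  have hqZ : Integrable ({x | f x = 0}.indicator q) τ := hq.indicator hZ
  have := ae_eq_zero_of_integral_contDiff_smul_eq_zero hqZ.locallyIntegrable fun φ hφ hc ↦ by
    replace hφ : ContDiff ℝ 1 φ := hφ.of_le (by exact_mod_cast le_top)
    have hcd : Continuous (fderiv ℝ φ) := hφ.continuous_fderiv (by norm_num)
    obtain ⟨C, hC⟩ := exists_abs_le_of_hasCompactSupport hφ.continuous hc
    obtain ⟨C', hC'⟩ := (hc.fderiv (𝕜 := ℝ)).exists_bound_of_continuous hcd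
    have hdm : ∀ w, Measurable fun x ↦ fderiv ℝ φ x w := fun w ↦
      measurable_fderiv_apply_const ℝ φ w
    have hdb : ∀ w x, |fderiv ℝ φ x w| ≤ C' * ‖w‖ := fun w x ↦
      ((fderiv ℝ φ x).le_opNorm w).trans (mul_le_mul_of_nonneg_right (hC' x) (norm_nonneg _))
    have hθm : ∀ k, Measurable fun x ↦ θ k (f x) := fun k ↦
      Measurable.comp (g := θ k) (by fun_prop) hfm
    let d : E → ℝ := fun x ↦ fderiv ℝ φ x v - fderiv ℝ f x v * fderiv ℝ φ x e
    have hdi : Integrable fun x ↦ u x * d x := by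
      refine h.integrable.mul_bdd (c := C' * ‖v‖ + K * ‖v‖ * (C' * ‖e‖))
        ((hdm v).sub (hm.mul (hdm e))).aestronglyMeasurable (ae_of_all _ fun x ↦ ?_)
      refine (norm_sub_le _ _).trans (add_le_add (hdb v x) ?_)
      rw [norm_mul]
      exact mul_le_mul (hmb x) (hdb e x) (abs_nonneg _) (by positivity)
    have hid := fun k ↦ h.integral_mul_comp_level hK hf v (hθ1 k) (hθd k) (hθL k) hφ hc
    have l1 : Tendsto (fun k ↦ ∫ x, u x * (d x * θ k (f x))) atTop (𝓝 (∫ x : E, (0 : ℝ))) := by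
      refine tendsto_integral_of_dominated_convergence (fun x ↦ |u x * d x|) ?_ hdi.abs ?_ ?_
      · intro k
        have := hdi.aestronglyMeasurable.mul (hθm k).aestronglyMeasurable
        simpa [mul_assoc, Pi.mul_def] using this
      · refine fun k ↦ ae_of_all _ fun x ↦ ?_
        rw [← mul_assoc, norm_mul]
        exact mul_le_of_le_one_right (abs_nonneg _) (hθ1 k _)
      · have : ∀ᵐ x, x ∉ {x | f x = 0} := measure_eq_zero_iff_ae_notMem.1 hZ0
        filter_upwards [this] with x hx
        have := ((hθlim (f x)).const_mul (d x)).const_mul (u x)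
        rwa [indicator_of_notMem (by simpa using hx), mul_zero, mul_zero] at this
    have l2 : Tendsto (fun k ↦ - ∫ x, φ x * θ k (f x) * q x ∂τ) atTop
        (𝓝 (- ∫ x, φ x • {x | f x = 0}.indicator q x ∂τ)) := by
      refine Tendsto.neg ?_
      refine tendsto_integral_of_dominated_convergence (fun x ↦ C * |q x|) ?_
        (hq.abs.const_mul C) ?_ ?_
      · exact fun k ↦ (hφ.continuous.measurable.mul (hθm k)).aestronglyMeasurable.mul
          hq.aestronglyMeasurable
      · refine fun k ↦ ae_of_all _ fun x ↦ ?_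
        rw [norm_mul, norm_mul]
        refine mul_le_mul_of_nonneg_right ?_ (abs_nonneg _)
        exact (mul_le_of_le_one_right (abs_nonneg _) (hθ1 k _)).trans (hC x)
      · refine ae_of_all _ fun x ↦ ?_
        have := ((hθlim (f x)).const_mul (φ x)).mul_const (q x)
        by_cases hx : f x = 0
        · simpa [hx] using this
        · simpa [hx] using this
    have l3 := tendsto_nhds_unique (l1.congr hid) l2
    rw [integral_zero] at l3
    linarith
  filter_upwards [this] with x hx hx0
  have h1 : q x = 0 := by rwa [indicator_of_mem (show x ∈ {x | f x = 0} from hx0)] at hx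
  simpa [q, sub_eq_zero] using h1

end LevelSets

/-! ### Surface measure on graphs -/

section Hausdorff

lemma euclideanHausdorffMeasure_image_le {X Y : Type*} [MetricSpace X] [MeasurableSpace X]
    [BorelSpace X] [MetricSpace Y] [MeasurableSpace Y] [BorelSpace Y] {K : ℝ≥0} {g : X → Y}
    (hg : LipschitzWith K g) (d : ℕ) (s : Set X) :
    μHE[d] (g '' s) ≤ (K : ℝ≥0∞) ^ d * μHE[d] s := by
  have := hg.hausdorffMeasure_image_le (d := (d : ℝ)) (Nat.cast_nonneg d) s
  rw [ENNReal.rpow_natCast] at this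
  simp only [Measure.euclideanHausdorffMeasure_def, Measure.smul_apply, ENNReal.smul_def,
    smul_eq_mul]
  rw [mul_left_comm]
  exact mul_le_mul_right this _

variable {n : ℕ} {e : EuclideanSpace ℝ (Fin n)} {f : EuclideanSpace ℝ (Fin n) → ℝ}

local notation "E" => EuclideanSpace ℝ (Fin n)

lemma finrank_orthogonal_span_singleton (he : ‖e‖ = 1) :
    Module.finrank ℝ (ℝ ∙ e)ᗮ = n - 1 := by
  have h1 : Module.finrank ℝ (ℝ ∙ e) = 1 := finrank_span_singleton (by
    intro h; simp [h] at he)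
  have h2 := (ℝ ∙ e).finrank_add_finrank_orthogonal
  rw [h1, finrank_euclideanSpace_fin] at h2
  omega

/-- Lebesgue measure splits as a product over the line spanned by `e` and its orthogonal hyperplane,
and the line has nonzero measure. This carries null sets between `volume` and surface measure. -/
lemma volume_cylinder_eq_zero_iff (he : ‖e‖ = 1) (A : Set (ℝ ∙ e)ᗮ) :
    volume {x : E | (ℝ ∙ e)ᗮ.orthogonalProjectionOnto x ∈ A} = 0 ↔ μHE[n - 1] A = 0 := by
  have hmp := (ℝ ∙ e).measurePreserving_measurableEquivProd (0 : E)
  rw [InnerProductSpace.euclideanHausdorffMeasure_eq_volume] at hmp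
  have h1 : {x : E | (ℝ ∙ e)ᗮ.orthogonalProjectionOnto x ∈ A} =
      (ℝ ∙ e).measurableEquivProd (0 : E) ⁻¹' (univ ×ˢ A) := by
    ext x; simp
  rw [h1, hmp.measure_preimage_equiv, Measure.volume_eq_prod, Measure.prod_prod, mul_eq_zero,
    ← finrank_orthogonal_span_singleton he, InnerProductSpace.euclideanHausdorffMeasure_eq_volume]
  refine or_iff_right ?_
  have : Nontrivial (ℝ ∙ e) := by
    refine ⟨⟨0, ⟨e, Submodule.mem_span_singleton_self e⟩, fun h ↦ ?_⟩⟩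
    have := congrArg Subtype.val h
    simp only [ZeroMemClass.coe_zero] at this
    simp [← this] at he
  exact (Measure.measure_univ_eq_zero.not).2 (NeZero.ne _)

/-- The parametrization of the zero set of `f` over the hyperplane orthogonal to `e`. -/
def graphMap (e : E) (f : E → ℝ) (w : (ℝ ∙ e)ᗮ) : E := w - f w • e

lemma exists_lipschitzWith_graphMap {K : ℝ≥0} (hK : LipschitzWith K f) :
    ∃ K', LipschitzWith K' (graphMap e f) := by
  have h1 : LipschitzWith 1 fun w : (ℝ ∙ e)ᗮ ↦ (w : E) := LipschitzWith.subtype_val _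
  have h2 : LipschitzWith ‖e‖₊ fun t : ℝ ↦ t • e :=
    ((ContinuousLinearMap.id ℝ ℝ).smulRight e).lipschitz.weaken (by
      simp [ContinuousLinearMap.nnnorm_smulRight_apply])
  exact ⟨_, h1.sub (h2.comp (hK.comp h1))⟩

lemma exists_eq_add_smul (x y : E)
    (h : (ℝ ∙ e)ᗮ.orthogonalProjectionOnto x = (ℝ ∙ e)ᗮ.orthogonalProjectionOnto y) :
    ∃ t : ℝ, x = y + t • e := by
  have h1 : (ℝ ∙ e)ᗮ.orthogonalProjectionOnto (x - y) = 0 := by rw [map_sub, h, sub_self]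
  have h2 : x - y ∈ (ℝ ∙ e)ᗮᗮ :=
    (Submodule.orthogonalProjectionOnto_eq_zero_iff).1 h1
  rw [Submodule.orthogonal_orthogonal, Submodule.mem_span_singleton] at h2
  obtain ⟨t, ht⟩ := h2
  exact ⟨t, by rw [ht]; abel⟩

lemma graphMap_orthogonalProjectionOnto (hf : ∀ x (t : ℝ), f (x + t • e) = f x + t) {y : E}
    (hy : f y = 0) : graphMap e f ((ℝ ∙ e)ᗮ.orthogonalProjectionOnto y) = y := by
  obtain ⟨t, ht⟩ := exists_eq_add_smul (e := e) y ((ℝ ∙ e)ᗮ.orthogonalProjectionOnto y : E)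
    (Submodule.orthogonalProjectionOnto_mem_subspace_eq_self _).symm
  have h1 := hf ((ℝ ∙ e)ᗮ.orthogonalProjectionOnto y : E) t
  rw [← ht, hy] at h1
  rw [graphMap, show f ((ℝ ∙ e)ᗮ.orthogonalProjectionOnto y : E) = -t by linarith]
  nth_rw 2 [ht]
  simp

/-- On `{f = 0}` the Lipschitz map `graphMap` inverts the projection along `e`, so the graph measure
is at most `K' ^ (n - 1)` times that of the shadow. -/
lemma euclideanHausdorffMeasure_le_projection (hf : ∀ x (t : ℝ), f (x + t • e) = f x + t)
    {K : ℝ≥0} (hK : LipschitzWith K f) :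
    ∃ c : ℝ≥0, ∀ S : Set E, (∀ x ∈ S, f x = 0) →
      μHE[n - 1] S ≤ c * μHE[n - 1] ((ℝ ∙ e)ᗮ.orthogonalProjectionOnto '' S) := by
  obtain ⟨K', hK'⟩ := exists_lipschitzWith_graphMap (e := e) hK
  refine ⟨K' ^ (n - 1), fun S hS ↦ ?_⟩
  have h1 : S = graphMap e f '' ((ℝ ∙ e)ᗮ.orthogonalProjectionOnto '' S) := by
    rw [image_image]
    ext y
    constructor
    · exact fun hy ↦ ⟨y, hy, graphMap_orthogonalProjectionOnto hf (hS y hy)⟩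
    · rintro ⟨x, hx, rfl⟩
      beta_reduce
      rwa [graphMap_orthogonalProjectionOnto hf (hS x hx)]
  conv_lhs => rw [h1]
  simpa using euclideanHausdorffMeasure_image_le hK' (n - 1) _

/-- Subsets of a graph that are null for the surface measure lie over null sets. -/
lemma volume_eq_zero_of_euclideanHausdorffMeasure_eq_zero (he : ‖e‖ = 1) {S : Set E}
    (hS : μHE[n - 1] S = 0) : volume {x | x - f x • e ∈ S} = 0 := by
  have hl : LipschitzWith 1 ((ℝ ∙ e)ᗮ.orthogonalProjectionOnto : E → (ℝ ∙ e)ᗮ) :=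
    (ℝ ∙ e)ᗮ.orthogonalProjectionOnto.lipschitz.weaken
      (Submodule.orthogonalProjectionOnto_norm_le _)
  have h1 := euclideanHausdorffMeasure_image_le hl (n - 1) S
  rw [hS, mul_zero, nonpos_iff_eq_zero, ← volume_cylinder_eq_zero_iff he] at h1
  refine measure_mono_null (fun x hx ↦ ?_) h1
  refine ⟨x - f x • e, hx, ?_⟩
  have : (ℝ ∙ e)ᗮ.orthogonalProjectionOnto e = 0 :=
    (Submodule.orthogonalProjectionOnto_eq_zero_iff).2 (by
      rw [Submodule.orthogonal_orthogonal]; exact Submodule.mem_span_singleton_self e)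
  rw [map_sub, map_smul, this, smul_zero, sub_zero]

/-- Subsets of a Lipschitz graph over null sets are null for the surface measure. -/
lemma euclideanHausdorffMeasure_eq_zero_of_volume_eq_zero (he : ‖e‖ = 1)
    (hf : ∀ x (t : ℝ), f (x + t • e) = f x + t) {K : ℝ≥0} (hK : LipschitzWith K f) {S : Set E}
    (hS0 : ∀ x ∈ S, f x = 0) (hS : volume {x | x - f x • e ∈ S} = 0) : μHE[n - 1] S = 0 := by
  obtain ⟨c, hc⟩ := euclideanHausdorffMeasure_le_projection hf hK
  have h1 : μHE[n - 1] ((ℝ ∙ e)ᗮ.orthogonalProjectionOnto '' S) = 0 := by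
    rw [← volume_cylinder_eq_zero_iff he]
    refine measure_mono_null ?_ hS
    rintro x ⟨y, hy, hxy⟩
    obtain ⟨t, rfl⟩ := exists_eq_add_smul x y hxy.symm
    rw [mem_ofPred_eq, hf, hS0 y hy, zero_add, add_sub_cancel_right]
    exact hy
  exact le_antisymm ((hc S hS0).trans (by rw [h1, mul_zero])) zero_le

lemma euclideanHausdorffMeasure_lt_top (he : ‖e‖ = 1)
    (hf : ∀ x (t : ℝ), f (x + t • e) = f x + t) {K : ℝ≥0} (hK : LipschitzWith K f) {S : Set E}
    (hS0 : ∀ x ∈ S, f x = 0) (hS : Bornology.IsBounded S) : μHE[n - 1] S < ⊤ := by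
  obtain ⟨c, hc⟩ := euclideanHausdorffMeasure_le_projection hf hK
  refine (hc S hS0).trans_lt (ENNReal.mul_lt_top coe_lt_top ?_)
  rw [← finrank_orthogonal_span_singleton he, InnerProductSpace.euclideanHausdorffMeasure_eq_volume]
  exact ((ℝ ∙ e)ᗮ.orthogonalProjectionOnto.lipschitz.isBounded_image hS).measure_lt_top

end Hausdorff

/-! ### Boundary charts and outer normals -/

section Normals

variable {n : ℕ} {e : EuclideanSpace ℝ (Fin n)} {f : EuclideanSpace ℝ (Fin n) → ℝ}
  {Ω U : Set (EuclideanSpace ℝ (Fin n))}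

local notation "E" => EuclideanSpace ℝ (Fin n)

/-- The function is `f x = ⟪e, x⟫ - γ (x - ⟪e, x⟫ • e)`. Unit growth along `e` makes the graph a
level set of a globally Lipschitz function, the form required by the results on level sets. -/
lemma HasLipschitzBoundary.exists_chart (hΩL : HasLipschitzBoundary Ω) {x₀ : E}
    (hx₀ : x₀ ∈ frontier Ω) :
    ∃ (e : E) (f : E → ℝ) (K : ℝ≥0) (r : ℝ), 0 < r ∧ ‖e‖ = 1 ∧ LipschitzWith K f ∧
      (∀ x (t : ℝ), f (x + t • e) = f x + t) ∧ ∀ x ∈ Metric.ball x₀ r, x ∈ Ω ↔ 0 < f x := by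
  obtain ⟨e, he, K, γ, hγ, r, hr, h⟩ := hΩL x₀ hx₀
  have h1 : LipschitzWith 1 fun x : E ↦ ⟪e, x⟫ :=
    (innerSL ℝ e).lipschitz.weaken (by
      rw [← NNReal.coe_le_coe, coe_nnnorm, innerSL_apply_norm, he]; simp)
  have h2 : LipschitzWith ‖e‖₊ fun t : ℝ ↦ t • e :=
    ((ContinuousLinearMap.id ℝ ℝ).smulRight e).lipschitz.weaken (by
      simp [ContinuousLinearMap.nnnorm_smulRight_apply])
  have h3 := h1.sub (hγ.comp (LipschitzWith.id.sub (h2.comp h1)))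
  refine ⟨e, fun x ↦ ⟪e, x⟫ - γ (x - ⟪e, x⟫ • e), _, r, hr, he, h3, fun x t ↦ ?_, fun x hx ↦ ?_⟩
  · have h4 : ⟪e, x + t • e⟫ = ⟪e, x⟫ + t := by
      rw [inner_add_right, inner_smul_right, real_inner_self_eq_norm_sq, he]; ring
    have h5 : x + t • e - (⟪e, x⟫ + t) • e = x - ⟪e, x⟫ • e := by rw [add_smul]; abel
    simp only [h4, h5]
    ring
  · rw [h x hx, sub_pos]

lemma eq_zero_of_mem_frontier (hΩ : IsOpen Ω) (hU : IsOpen U) (hf : Continuous f)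
    (hUΩ : ∀ x ∈ U, x ∈ Ω ↔ 0 < f x) {x : E} (hxU : x ∈ U) (hx : x ∈ frontier Ω) : f x = 0 := by
  rw [hΩ.frontier_eq] at hx
  refine le_antisymm (not_lt.1 (mt (hUΩ x hxU).2 hx.2)) ?_
  by_contra! hneg
  obtain ⟨y, ⟨hy1, hy2⟩, hyΩ⟩ := mem_closure_iff.1 hx.1 _
    (hU.inter (isOpen_lt hf continuous_const)) ⟨hxU, hneg⟩
  exact absurd ((hUΩ y hy1).1 hyΩ) (not_lt.2 (le_of_lt hy2))

lemma IsOuterNormal.unique {x ν ν' : E} (h : IsOuterNormal Ω x ν) (h' : IsOuterNormal Ω x ν') :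
    ν = ν' := by
  by_contra hne
  have hc : ⟪ν, ν'⟫ < 1 := (inner_lt_one_iff_real_of_norm_eq_one h.1 h'.1).2 hne
  set w := ν' - ν
  have hw : 0 < ‖w‖ := norm_pos_iff.2 (sub_ne_zero.2 (Ne.symm hne))
  -- A small step along `w = ν' - ν` must land inside `Ω` according to `ν` and outside according to
  -- `ν'`. This `ε` makes both cone conditions hold with a factor two to spare.
  set ε := (1 - ⟪ν, ν'⟫) / (2 * ‖w‖)
  have hε : 0 < ε := div_pos (sub_pos.2 hc) (by positivity)
  obtain ⟨δ, hδ, h1⟩ := h.2 ε hε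
  obtain ⟨δ', hδ', h2⟩ := h'.2 ε hε
  obtain ⟨t, ht0, ht⟩ : ∃ t > 0, t * ‖w‖ < min δ δ' :=
    ⟨min δ δ' / (2 * ‖w‖), by positivity, by
      have : 0 < min δ δ' := lt_min hδ hδ'
      field_simp; linarith⟩
  have hd : dist (x + t • w) x = t * ‖w‖ := by
    rw [dist_eq_norm, add_sub_cancel_left, norm_smul, Real.norm_of_nonneg ht0.le]
  have hi1 : ⟪w, ν⟫ = -(1 - ⟪ν, ν'⟫) := by
    rw [inner_sub_left, real_inner_self_eq_norm_sq, h.1, real_inner_comm]; ring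
  have hi2 : ⟪w, ν'⟫ = 1 - ⟪ν, ν'⟫ := by
    rw [inner_sub_left, real_inner_self_eq_norm_sq, h'.1]; ring
  have hεw : ε * (t * ‖w‖) = t * (1 - ⟪ν, ν'⟫) / 2 := by
    simp only [ε]; field_simp
  have hpos : 0 < t * (1 - ⟪ν, ν'⟫) := mul_pos ht0 (sub_pos.2 hc)
  refine (h2 (x + t • w) (by rw [Metric.mem_ball, hd]; exact ht.trans_le (min_le_right _ _))).2 ?_
    ((h1 (x + t • w) (by rw [Metric.mem_ball, hd]; exact ht.trans_le (min_le_left _ _))).1 ?_)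
  · rw [add_sub_cancel_left, norm_smul, Real.norm_of_nonneg ht0.le, hεw, inner_smul_left, hi2]
    simp only [conj_trivial]; linarith
  · rw [add_sub_cancel_left, norm_smul, Real.norm_of_nonneg ht0.le, hεw, inner_smul_left, hi1]
    simp only [conj_trivial]; linarith

/-- The first-order expansion of `f` at `x`, with error at most `ε ‖∇f‖ ‖y - x‖`, fixes the sign of
`f y` outside the cone of aperture `ε` around the tangent plane. -/
lemma isOuterNormal_of_differentiableAt (hU : IsOpen U) (hUΩ : ∀ x ∈ U, x ∈ Ω ↔ 0 < f x) {x : E}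
    (hxU : x ∈ U) (hx : f x = 0) (hd : DifferentiableAt ℝ f x) (hg : gradient f x ≠ 0) :
    IsOuterNormal Ω x (-(‖gradient f x‖⁻¹ • gradient f x)) := by
  set g := gradient f x
  have hg0 : 0 < ‖g‖ := norm_pos_iff.2 hg
  refine ⟨by rw [norm_neg, norm_smul, norm_inv, norm_norm, inv_mul_cancel₀ hg0.ne'],
    fun ε hε ↦ ?_⟩
  have hD := hd.hasFDerivAt.isLittleO.def (c := ε * ‖g‖) (by positivity)
  obtain ⟨δ, hδ, hball⟩ := Metric.eventually_nhds_iff_ball.1 (hD.and (hU.mem_nhds hxU))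
  refine ⟨δ, hδ, fun y hy ↦ ?_⟩
  obtain ⟨h1, hyU⟩ := hball y hy
  have hin : fderiv ℝ f x (y - x) = ⟪y - x, g⟫ := by
    rw [real_inner_comm]; simp [g, gradient]
  rw [hx, sub_zero, hin, Real.norm_eq_abs] at h1
  have h2 := abs_le.1 h1
  have hscal : ⟪y - x, -(‖g‖⁻¹ • g)⟫ = -(‖g‖⁻¹ * ⟪y - x, g⟫) := by
    rw [inner_neg_right, inner_smul_right]
  have hmul : ‖g‖ * (‖g‖⁻¹ * ⟪y - x, g⟫) = ⟪y - x, g⟫ := by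
    rw [← mul_assoc, mul_inv_cancel₀ hg0.ne', one_mul]
  rw [hscal]
  constructor
  · intro h3
    rw [hUΩ y hyU]
    have := mul_lt_mul_of_pos_left (neg_lt_neg_iff.1 h3) hg0
    rw [hmul] at this
    linarith
  · intro h3
    rw [hUΩ y hyU, not_lt]
    have := mul_lt_mul_of_pos_left h3 hg0
    rw [mul_neg, hmul] at this
    linarith

lemma outerNormal_eq {x ν : E} (h : IsOuterNormal Ω x ν) : outerNormal Ω x = ν := by
  have hex : ∃ ν, IsOuterNormal Ω x ν := ⟨ν, h⟩
  rw [outerNormal, dif_pos hex]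
  exact hex.choose_spec.unique h

end Normals

/-! ### Structure of the derivative on the boundary -/

section Trace

variable {n : ℕ} {u : EuclideanSpace ℝ (Fin n) → ℝ}
    {τ : Measure (EuclideanSpace ℝ (Fin n))} [IsFiniteMeasure τ]
    {p : EuclideanSpace ℝ (Fin n) → EuclideanSpace ℝ (Fin n)}
    {Ω : Set (EuclideanSpace ℝ (Fin n))}

local notation "E" => EuclideanSpace ℝ (Fin n)

lemma HasDerivDensity.eq_inner_smul_gradient (h : HasDerivDensity u τ p) {e : E} {f : E → ℝ}
    {K : ℝ≥0} (hK : LipschitzWith K f) (hf : ∀ x (t : ℝ), f (x + t • e) = f x + t) :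
    ∀ᵐ x ∂τ, f x = 0 → p x = ⟪p x, e⟫ • gradient f x := by
  have h1 : ∀ i : Fin n, ∀ᵐ x ∂τ, f x = 0 → ⟪p x, EuclideanSpace.single i (1 : ℝ)⟫ =
      fderiv ℝ f x (EuclideanSpace.single i (1 : ℝ)) * ⟪p x, e⟫ :=
    fun i ↦ h.inner_eq_on_zeroSet hK hf _
  filter_upwards [ae_all_iff.2 h1] with x hx hx0
  ext i
  have h2 := hx i hx0
  have h3 : fderiv ℝ f x (EuclideanSpace.single i (1 : ℝ)) = gradient f x i := by
    have : ⟪gradient f x, EuclideanSpace.single i (1 : ℝ)⟫ =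
        fderiv ℝ f x (EuclideanSpace.single i (1 : ℝ)) := by simp [gradient]
    rw [← this, EuclideanSpace.inner_single_right]; simp
  rw [h3, EuclideanSpace.inner_single_right] at h2
  simp only [one_mul, conj_trivial] at h2
  rw [h2]; simp [mul_comm]

omit [IsFiniteMeasure τ] in
lemma HasDerivDensity.eq_zero_of_isOpen (h : HasDerivDensity u τ p) {U : Set E} (hU : IsOpen U)
    (hu : ∀ᵐ x, x ∈ U → u x = 0) : ∀ᵐ x ∂τ, x ∈ U → p x = 0 := by
  refine hU.ae_eq_zero_of_integral_contDiff_smul_eq_zero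
    (h.integrable_density.locallyIntegrable.locallyIntegrableOn U) fun φ hφ hc hs ↦ ?_
  have h1 := h.integral_gradient φ (hφ.of_le (by exact_mod_cast le_top)) hc
  rw [eq_comm, neg_eq_iff_eq_neg] at h1
  rw [h1, neg_eq_zero]
  refine integral_eq_zero_of_ae ?_
  filter_upwards [hu] with x hx
  by_cases hxU : x ∈ U
  · simp [hx hxU]
  · have : fderiv ℝ φ x = 0 := by
      by_contra hne
      exact hxU (hs (support_fderiv_subset ℝ hne))
    simp [gradient, this]

lemma isOuterNormal_outerNormal_or (x : E) :
    IsOuterNormal Ω x (outerNormal Ω x) ∨ outerNormal Ω x = 0 := by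
  rw [outerNormal]
  split_ifs with h
  · exact Or.inl h.choose_spec
  · exact Or.inr rfl

lemma norm_outerNormal_le (x : E) : ‖outerNormal Ω x‖ ≤ 1 := by
  rcases isOuterNormal_outerNormal_or (Ω := Ω) x with h | h
  · exact h.1.le
  · simp [h]

lemma measurable_gradient (f : E → ℝ) : Measurable (gradient f) :=
  (InnerProductSpace.toDual ℝ E).symm.continuous.measurable.comp (measurable_fderiv ℝ f)

/-- Data of a Lipschitz chart near a boundary point, with the consequences that are used for
traces. -/
lemma exists_ball_boundary (hΩ : IsOpen Ω) (hΩL : HasLipschitzBoundary Ω) {x₀ : E}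
    (hx₀ : x₀ ∈ frontier Ω) :
    ∃ (e : E) (f : E → ℝ) (K : ℝ≥0) (r : ℝ), 0 < r ∧ ‖e‖ = 1 ∧ LipschitzWith K f ∧
      (∀ x (t : ℝ), f (x + t • e) = f x + t) ∧
      (∀ x ∈ Metric.ball x₀ r ∩ frontier Ω, f x = 0) ∧
      (∀ x ∈ Metric.ball x₀ r ∩ frontier Ω, DifferentiableAt ℝ f x →
        outerNormal Ω x = -(‖gradient f x‖⁻¹ • gradient f x) ∧ ‖outerNormal Ω x‖ = 1) ∧
      (∀ S ⊆ Metric.ball x₀ r ∩ frontier Ω, (∀ x ∈ S, ¬ DifferentiableAt ℝ f x) →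
        volume {x | x - f x • e ∈ S} = 0) := by
  obtain ⟨e, f, K, r, hr, he, hK, hf, hball⟩ := hΩL.exists_chart hx₀
  have h0 : ∀ x ∈ Metric.ball x₀ r ∩ frontier Ω, f x = 0 := fun x hx ↦
    eq_zero_of_mem_frontier hΩ Metric.isOpen_ball hK.continuous hball hx.1 hx.2
  refine ⟨e, f, K, r, hr, he, hK, hf, h0, fun x hx hd ↦ ?_, fun S hS hnd ↦ ?_⟩
  · have h1 : fderiv ℝ f x e = 1 := by
      have h2 := hd.hasFDerivAt.hasLineDerivAt e
      rw [HasLineDerivAt] at h2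
      simp_rw [hf] at h2
      have h3 : HasDerivAt (fun t : ℝ ↦ f x + t) 1 0 := (hasDerivAt_id 0).const_add (f x)
      exact h2.unique h3
    have hg : gradient f x ≠ 0 := fun hg ↦ by
      have : fderiv ℝ f x = 0 := by simpa [gradient] using hg
      simp [this] at h1
    have hn := isOuterNormal_of_differentiableAt Metric.isOpen_ball hball hx.1 (h0 x hx) hd hg
    rw [outerNormal_eq hn]
    exact ⟨rfl, hn.1⟩
  -- Non-differentiability of `f` is invariant along `e`, so the whole cylinder over `S` lies in the
  -- Rademacher null set.
  · refine measure_mono_null (fun x hx ↦ ?_) (hK.ae_differentiableAt (μ := volume))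
    refine fun hd ↦ hnd _ hx ?_
    have h1 : DifferentiableAt ℝ (fun y ↦ f (y + f x • e)) (x - f x • e) := by
      refine DifferentiableAt.comp (x - f x • e) (g := f) ?_ (by fun_prop)
      simpa using hd
    simp_rw [hf] at h1
    simpa using h1.sub_const (f x)

/-- Each property is local and passes to finite unions, so compactness of `∂Ω` reduces it to one
chart. There Rademacher's theorem identifies the normal with `-∇f/‖∇f‖` outside a surface-null set.
-/
lemma measure_frontier_lt_top_and (hΩ : IsOpen Ω) (hΩb : Bornology.IsBounded Ω)
    (hΩL : HasLipschitzBoundary Ω) :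
    μHE[n - 1] (frontier Ω) < ⊤ ∧
      AEStronglyMeasurable (outerNormal Ω) (μHE[n - 1].restrict (frontier Ω)) ∧
      ∀ᵐ x ∂(μHE[n - 1].restrict (frontier Ω)), ‖outerNormal Ω x‖ = 1 := by
  have hcomp : IsCompact (frontier Ω) :=
    Metric.isCompact_of_isClosed_isBounded isClosed_frontier
      (hΩb.closure.subset frontier_subset_closure)
  have hfm : MeasurableSet (frontier Ω) := isClosed_frontier.measurableSet
  have := hcomp.induction_on (p := fun S ↦ μHE[n - 1] (S ∩ frontier Ω) < ⊤ ∧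
      AEStronglyMeasurable (outerNormal Ω) (μHE[n - 1].restrict (S ∩ frontier Ω)) ∧
      ∀ᵐ x ∂(μHE[n - 1].restrict (S ∩ frontier Ω)), ‖outerNormal Ω x‖ = 1) (by simp) ?_ ?_ ?_
  · simpa using this
  · intro S T hST hT
    have hle := Measure.restrict_mono (inter_subset_inter_left (frontier Ω) hST)
      (le_refl (μHE[n - 1] : Measure E))
    exact ⟨(measure_mono (inter_subset_inter_left _ hST)).trans_lt hT.1,
      hT.2.1.mono_measure hle, hT.2.2.filter_mono (ae_mono hle)⟩
  · intro S T hS hT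
    rw [union_inter_distrib_right]
    refine ⟨measure_union_lt_top hS.1 hT.1, aestronglyMeasurable_union_iff.2 ⟨hS.2.1, hT.2.1⟩, ?_⟩
    rw [ae_restrict_union_iff]
    exact ⟨hS.2.2, hT.2.2⟩
  · intro x₀ hx₀
    obtain ⟨e, f, K, r, hr, he, hK, hf, h0, hdiff, hnull⟩ := exists_ball_boundary hΩ hΩL hx₀
    refine ⟨_, mem_nhdsWithin_of_mem_nhds (Metric.ball_mem_nhds x₀ hr), ?_⟩
    have hbm : MeasurableSet (Metric.ball x₀ r ∩ frontier Ω) :=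
      Metric.isOpen_ball.measurableSet.inter hfm
    have hae : ∀ᵐ x ∂(μHE[n - 1].restrict (Metric.ball x₀ r ∩ frontier Ω)),
        DifferentiableAt ℝ f x := by
      rw [ae_restrict_iff' hbm, ae_iff]
      refine euclideanHausdorffMeasure_eq_zero_of_volume_eq_zero he hf hK ?_
        (hnull _ ?_ ?_)
      · intro x hx
        simp only [mem_ofPred_eq, Classical.not_imp] at hx
        exact h0 x hx.1
      · intro x hx
        simp only [mem_ofPred_eq, Classical.not_imp] at hx
        exact hx.1
      · intro x hx
        simp only [mem_ofPred_eq, Classical.not_imp] at hx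
        exact hx.2
    refine ⟨euclideanHausdorffMeasure_lt_top he hf hK h0
      (Metric.isBounded_ball.subset inter_subset_left), ?_, ?_⟩
    · refine AEStronglyMeasurable.congr (f := fun x ↦ -(‖gradient f x‖⁻¹ • gradient f x)) ?_ ?_
      · have := measurable_gradient f
        exact Measurable.aestronglyMeasurable (by fun_prop)
      · filter_upwards [hae, ae_restrict_mem hbm] with x hx hx'
        exact (hdiff x hx' hx).1.symm
    · filter_upwards [hae, ae_restrict_mem hbm] with x hx hx'
      exact (hdiff x hx' hx).2

/-- On a Lipschitz boundary the derivative of a function of bounded variation is absolutely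
continuous with respect to surface measure and directed along the normal. -/
lemma HasDerivDensity.boundary_structure (h : HasDerivDensity u τ p) (hΩ : IsOpen Ω)
    (hΩb : Bornology.IsBounded Ω) (hΩL : HasLipschitzBoundary Ω) :
    (∀ N : Set E, MeasurableSet N → N ⊆ frontier Ω → μHE[n - 1] N = 0 →
        ∀ᵐ x ∂τ, x ∈ N → p x = 0) ∧
      ∀ᵐ x ∂τ, x ∈ frontier Ω → p x = ⟪p x, outerNormal Ω x⟫ • outerNormal Ω x := by
  have hcomp : IsCompact (frontier Ω) :=
    Metric.isCompact_of_isClosed_isBounded isClosed_frontier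
      (hΩb.closure.subset frontier_subset_closure)
  have hfm : MeasurableSet (frontier Ω) := isClosed_frontier.measurableSet
  have := hcomp.induction_on (p := fun S ↦ (∀ N : Set E, MeasurableSet N → N ⊆ frontier Ω →
      μHE[n - 1] N = 0 → ∀ᵐ x ∂τ, x ∈ S → x ∈ N → p x = 0) ∧
      ∀ᵐ x ∂τ, x ∈ S → x ∈ frontier Ω → p x = ⟪p x, outerNormal Ω x⟫ • outerNormal Ω x)
      (by simp) ?_ ?_ ?_
  · refine ⟨fun N hN hNf hN0 ↦ ?_, ?_⟩
    · filter_upwards [this.1 N hN hNf hN0] with x hx hxN using hx (hNf hxN) hxN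
    · filter_upwards [this.2] with x hx hxN using hx hxN hxN
  · intro S T hST hT
    refine ⟨fun N hN hNf hN0 ↦ ?_, ?_⟩
    · filter_upwards [hT.1 N hN hNf hN0] with x hx hxS using hx (hST hxS)
    · filter_upwards [hT.2] with x hx hxS using hx (hST hxS)
  · intro S T hS hT
    refine ⟨fun N hN hNf hN0 ↦ ?_, ?_⟩
    · filter_upwards [hS.1 N hN hNf hN0, hT.1 N hN hNf hN0] with x hx hx' hxS using
        hxS.elim hx hx'
    · filter_upwards [hS.2, hT.2] with x hx hx' hxS using hxS.elim hx hx'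
  · intro x₀ hx₀
    obtain ⟨e, f, K, r, hr, he, hK, hf, h0, hdiff, hnull⟩ := exists_ball_boundary hΩ hΩL hx₀
    refine ⟨_, mem_nhdsWithin_of_mem_nhds (Metric.ball_mem_nhds x₀ hr), ?_, ?_⟩
    · intro N hN hNf hN0
      have hSm : MeasurableSet (Metric.ball x₀ r ∩ N) := Metric.isOpen_ball.measurableSet.inter hN
      have h0' : ∀ x ∈ Metric.ball x₀ r ∩ N, f x = 0 := fun x hx ↦ h0 x ⟨hx.1, hNf hx.2⟩
      have h1 := h.inner_eq_zero_of_null hK.continuous.measurable hf hSm h0'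
        (volume_eq_zero_of_euclideanHausdorffMeasure_eq_zero he
          (measure_mono_null inter_subset_right hN0))
      filter_upwards [h1, h.eq_inner_smul_gradient hK hf] with x hx hx' hxS hxN
      rw [hx' (h0' x ⟨hxS, hxN⟩), hx ⟨hxS, hxN⟩, zero_smul]
    -- `Z` lies over a Lebesgue null set, hence `⟪p, e⟫`, and with it `p`, vanishes a.e. on `Z`.
    -- Elsewhere `∇f` is a multiple of the outer normal.
    · let Z : Set E := (Metric.ball x₀ r ∩ frontier Ω) ∩ {x | DifferentiableAt ℝ f x}ᶜ
      have hZ : MeasurableSet Z := (Metric.isOpen_ball.measurableSet.inter hfm).inter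
        (measurableSet_of_differentiableAt ℝ f).compl
      have h1 := h.inner_eq_zero_of_null hK.continuous.measurable hf hZ (fun x hx ↦ h0 x hx.1)
        (hnull Z inter_subset_left fun x hx ↦ hx.2)
      filter_upwards [h1, h.eq_inner_smul_gradient hK hf] with x hx hx' hxS hxf
      have hp := hx' (h0 x ⟨hxS, hxf⟩)
      by_cases hd : DifferentiableAt ℝ f x
      · obtain ⟨h2, h3⟩ := hdiff x ⟨hxS, hxf⟩ hd
        have hg : ‖gradient f x‖ ≠ 0 := fun hg ↦ by
          rw [h2, hg] at h3; simp at h3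
        have h4 : gradient f x = -‖gradient f x‖ • outerNormal Ω x := by
          rw [h2, smul_neg, neg_smul, neg_neg, smul_smul, mul_inv_cancel₀ hg, one_smul]
        rw [h4, smul_smul] at hp
        set c := ⟪p x, e⟫ * -‖gradient f x‖
        have h5 : ⟪p x, outerNormal Ω x⟫ = c := by
          rw [hp, inner_smul_left, real_inner_self_eq_norm_sq, h3]; simp
        rw [h5]; exact hp
      · have : p x = 0 := by rw [hp, hx ⟨⟨hxS, hxf⟩, hd⟩, zero_smul]
        simp [this]

end Trace

/-! ### Traces and the energy as a total variation -/

section Energy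

variable {n : ℕ} {u : EuclideanSpace ℝ (Fin n) → ℝ}
    {Ω : Set (EuclideanSpace ℝ (Fin n))}

local notation "E" => EuclideanSpace ℝ (Fin n)

lemma isDerivMeasure_bvDeriv (h : IsBV u) : IsDerivMeasure u (bvDeriv u) := by
  rw [bvDeriv, dif_pos h.2]
  exact h.2.choose_spec

lemma integrable_lsmul_of_hasCompactSupport {D : VectorMeasure E E} [IsFiniteMeasure D.variation]
    {φ : E → ℝ} (hφ : Continuous φ) (hc : HasCompactSupport φ) : D.Integrable φ :=
  integrable_of_hasCompactSupport hφ hc D.variation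

/-- A density for the derivative of a function of bounded variation with respect to its total
variation. -/
lemma IsDerivMeasure.exists_density (hu : Integrable u) {D : VectorMeasure E E}
    (hD : IsDerivMeasure u D) :
    ∃ p : E → E, HasDerivDensity u D.variation p ∧ D.variation.withDensityᵥ p = D ∧
      ∫ x, ‖p x‖ ∂D.variation = D.variation.real univ := by
  have := hD.1
  obtain ⟨p, -, hp, hpD⟩ := exists_withDensityᵥ_variation_eq D
  refine ⟨p, ⟨hu, hp, fun φ hφ hc ↦ ?_⟩, hpD, ?_⟩
  · obtain ⟨C, hC⟩ := exists_abs_le_of_hasCompactSupport hφ.continuous hc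
    rw [hD.2 φ hφ hc, ← integral_withDensityᵥ_lsmul hp hφ.continuous.measurable hC, hpD]
  · have h1 := Measure.variation_withDensityᵥ hp
    rw [hpD] at h1
    rw [integral_norm_eq_lintegral_enorm hp.aestronglyMeasurable, Measure.real]
    conv_rhs => rw [h1]
    rw [withDensity_apply _ MeasurableSet.univ, Measure.restrict_univ]

lemma IsDerivMeasure.unique {D D' : VectorMeasure E E} (hD : IsDerivMeasure u D)
    (hD' : IsDerivMeasure u D') : D = D' := by
  have := hD.1
  have := hD'.1
  refine eq_of_integral_contDiff_eq fun φ hφ hc ↦ ?_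
  have h1 : ContDiff ℝ 1 φ := hφ.of_le (by exact_mod_cast le_top)
  rw [← neg_inj, ← hD.2 φ h1 hc, hD'.2 φ h1 hc]

lemma restrict_withDensityᵥ {τ : Measure E} {p : E → E} (hp : Integrable p τ) {A : Set E}
    (hA : MeasurableSet A) : (τ.withDensityᵥ p).restrict A = (τ.restrict A).withDensityᵥ p := by
  ext1 s hs
  rw [VectorMeasure.restrict_apply _ hA hs, withDensityᵥ_apply hp (hs.inter hA),
    withDensityᵥ_apply hp.restrict hs, Measure.restrict_restrict hs]

lemma variation_closure_compl_eq_zero (hu : u ∈ A0 Ω) :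
    (bvDeriv u).variation (closure Ω)ᶜ = 0 := by
  have hD := isDerivMeasure_bvDeriv hu.1
  have := hD.1
  obtain ⟨p, hp, hpD, -⟩ := hD.exists_density hu.1.1
  have h1 := hp.eq_zero_of_isOpen (U := (closure Ω)ᶜ) isClosed_closure.isOpen_compl (by
    filter_upwards [hu.2] with x hx hxc using hx fun h ↦ hxc (subset_closure h))
  rw [← hpD, Measure.variation_withDensityᵥ hp.integrable_density,
    withDensity_apply _ isClosed_closure.measurableSet.compl]
  rw [setLIntegral_congr_fun_ae (g := fun _ ↦ 0) isClosed_closure.measurableSet.compl]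
  · simp
  · filter_upwards [h1] with x hx hxc
    simp [hx hxc]

/-- The distributional identity for a function vanishing outside `Ω` splits into an interior and a
boundary part. -/
lemma integral_gradient_add_eq (hΩ : IsOpen Ω) (hu : u ∈ A0 Ω) {φ : E → ℝ} (hφ : ContDiff ℝ 1 φ)
    (hc : HasCompactSupport φ) :
    (∫ x in Ω, u x • gradient φ x)
      + ((bvDeriv u).restrict Ω).integral φ (ContinuousLinearMap.lsmul ℝ ℝ)
      = - ((bvDeriv u).restrict (frontier Ω)).integral φ (ContinuousLinearMap.lsmul ℝ ℝ) := by
  have hD := isDerivMeasure_bvDeriv hu.1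
  have := hD.1
  have hi := integrable_lsmul_of_hasCompactSupport (D := bvDeriv u) hφ.continuous hc
  have h1 : ∫ x in Ω, u x • gradient φ x = ∫ x, u x • gradient φ x := by
    refine setIntegral_eq_integral_of_ae_compl_eq_zero ?_
    filter_upwards [hu.2] with x hx hxc
    rw [hx hxc, zero_smul]
  have hdisj : Disjoint Ω (frontier Ω) := by
    rw [hΩ.frontier_eq]; exact disjoint_sdiff_right
  have h2 : (bvDeriv u).integral φ (ContinuousLinearMap.lsmul ℝ ℝ) =
      ((bvDeriv u).restrict Ω).integral φ (ContinuousLinearMap.lsmul ℝ ℝ) +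
      ((bvDeriv u).restrict (frontier Ω)).integral φ (ContinuousLinearMap.lsmul ℝ ℝ) := by
    rw [← VectorMeasure.setIntegral_union hdisj hΩ.measurableSet
      isClosed_frontier.measurableSet hi.restrict hi.restrict]
    have hcl : Ω ∪ frontier Ω = closure Ω := by
      rw [hΩ.frontier_eq, union_sdiff_cancel subset_closure]
    rw [hcl, ← VectorMeasure.setIntegral_add_compl isClosed_closure.measurableSet hi]
    rw [VectorMeasure.setIntegral_of_variation_apply_eq_zero _ (variation_closure_compl_eq_zero hu),
      add_zero]
  rw [h1, hD.2 φ hφ hc, h2]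
  abel

/-- Every function in `A₀` has a trace. -/
theorem exists_isTrace (hΩ : IsOpen Ω) (hΩb : Bornology.IsBounded Ω)
    (hΩL : HasLipschitzBoundary Ω) (hu : u ∈ A0 Ω) : ∃ g, IsTrace Ω u g := by
  have hD := isDerivMeasure_bvDeriv hu.1
  have := hD.1
  obtain ⟨p, hp, hpD, -⟩ := hD.exists_density hu.1.1
  set τ := (bvDeriv u).variation
  have hfm : MeasurableSet (frontier Ω) := isClosed_frontier.measurableSet
  obtain ⟨hfin, hνm, -⟩ := measure_frontier_lt_top_and hΩ hΩb hΩL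
  obtain ⟨hac, hstr⟩ := hp.boundary_structure hΩ hΩb hΩL
  set σ := (μHE[n - 1] : Measure E).restrict (frontier Ω) with hσ
  have : IsFiniteMeasure σ := ⟨by rw [hσ, Measure.restrict_apply_univ]; exact hfin⟩
  -- A Borel version of the normal, bounded by one everywhere. It can be used under `τ` because the
  -- surface-null set where it differs from `outerNormal Ω` carries no derivative, by `hac`.
  let ν : E → E := fun x ↦ if ‖hνm.mk _ x‖ ≤ 1 then hνm.mk _ x else 0
  have hmk : Measurable (hνm.mk _) := hνm.stronglyMeasurable_mk.measurable
  have hν : Measurable ν :=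
    Measurable.ite (measurableSet_le hmk.norm measurable_const) hmk measurable_const
  have hν1 : ∀ x, ‖ν x‖ ≤ 1 := fun x ↦ by
    by_cases hx : ‖hνm.mk _ x‖ ≤ 1 <;> simp [ν, hx]
  have hνeq : outerNormal Ω =ᵐ[σ] ν := by
    filter_upwards [hνm.ae_eq_mk] with x hx
    have : ‖hνm.mk _ x‖ ≤ 1 := hx ▸ norm_outerNormal_le x
    simp only [ν, this, if_true, hx]
  have hpν : ∀ᵐ x ∂(τ.restrict (frontier Ω)), p x = ⟪p x, ν x⟫ • ν x := by
    rw [ae_restrict_iff' hfm]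
    obtain ⟨N, hNsub, hNm, hN0⟩ := exists_measurable_superset_of_null (ae_iff.1 hνeq)
    have h1 := hac (N ∩ frontier Ω) (hNm.inter hfm) inter_subset_right (by
      rwa [hσ, Measure.restrict_apply hNm] at hN0)
    filter_upwards [h1, hstr] with x hx hx' hxf
    by_cases hxN : x ∈ N
    · simp [hx ⟨hxN, hxf⟩]
    · have : outerNormal Ω x = ν x := by
        by_contra hne
        exact hxN (hNsub hne)
      rw [← this]; exact hx' hxf
  have hpνi : Integrable (fun x ↦ ⟪p x, ν x⟫) (τ.restrict (frontier Ω)) := by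
    refine hp.integrable_density.restrict.norm.mono'
      (hp.integrable_density.restrict.aestronglyMeasurable.inner hν.aestronglyMeasurable)
      (ae_of_all _ fun x ↦ ?_)
    exact (norm_inner_le_norm _ _).trans (mul_le_of_le_one_right (norm_nonneg _) (hν1 x))
  -- The normal component of `Du` on `∂Ω`, absolutely continuous with respect to surface measure.
  let κ : SignedMeasure E := (τ.restrict (frontier Ω)).withDensityᵥ fun x ↦ ⟪p x, ν x⟫
  have hκ : κ ≪ᵥ σ.toENNRealVectorMeasure := by
    refine VectorMeasure.AbsolutelyContinuous.mk fun s hs h0 ↦ ?_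
    rw [Measure.toENNRealVectorMeasure_apply_measurable hs, hσ, Measure.restrict_apply hs] at h0
    rw [withDensityᵥ_apply hpνi hs, Measure.restrict_restrict hs]
    refine integral_eq_zero_of_ae ?_
    refine (ae_restrict_iff' (hs.inter hfm)).2 ?_
    filter_upwards [hac _ (hs.inter hfm) inter_subset_right h0] with x hx hxs
    simp [hx hxs]
  have hrn := SignedMeasure.withDensityᵥ_rnDeriv_eq κ σ hκ
  set g₀ := κ.rnDeriv σ
  have hg₀ : Integrable g₀ σ := SignedMeasure.integrable_rnDeriv _ _
  have hswap : ∀ (b : E → ℝ) (C : ℝ), Measurable b → (∀ x, |b x| ≤ C) →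
      ∫ x, b x * g₀ x ∂σ = ∫ x in frontier Ω, b x * ⟪p x, ν x⟫ ∂τ := fun b C hb hC ↦ by
    have h1 := integral_withDensityᵥ_lsmul hg₀ hb hC
    have h2 := integral_withDensityᵥ_lsmul hpνi hb hC
    rw [hrn] at h1
    simp only [smul_eq_mul] at h1 h2
    rw [← h1, ← h2]
  -- The minus sign reflects the jump from the inner trace to `0` in the outward direction.
  refine ⟨fun x ↦ - g₀ x, hg₀.neg, fun φ hφ hc ↦ ?_⟩
  obtain ⟨C, hC⟩ := exists_abs_le_of_hasCompactSupport hφ.continuous hc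
  have hφm := hφ.continuous.measurable
  have hC0 : 0 ≤ C := (abs_nonneg _).trans (hC 0)
  rw [integral_gradient_add_eq hΩ hu hφ hc]
  conv_lhs => rw [← hpD]
  rw [restrict_withDensityᵥ hp.integrable_density hfm,
    integral_withDensityᵥ_lsmul hp.integrable_density.restrict hφm hC]
  have h1 : ∫ x, (φ x * -g₀ x) • outerNormal Ω x ∂σ = - ∫ x, (φ x * g₀ x) • ν x ∂σ := by
    rw [← integral_neg]
    refine integral_congr_ae ?_
    filter_upwards [hνeq] with x hx
    rw [hx, mul_neg, neg_smul]
  rw [h1, neg_inj]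
  have hi1 : Integrable (fun x ↦ φ x • p x) (τ.restrict (frontier Ω)) :=
    hp.integrable_density.restrict.bdd_smul C hφ.continuous.aestronglyMeasurable (ae_of_all _ hC)
  have hi2 : Integrable (fun x ↦ (φ x * g₀ x) • ν x) σ :=
    (hg₀.bdd_mul hφ.continuous.aestronglyMeasurable (ae_of_all _ hC)).smul_bdd 1
      hν.aestronglyMeasurable (ae_of_all _ hν1)
  ext i
  have e1 := (EuclideanSpace.proj (𝕜 := ℝ) i).integral_comp_comm hi1
  have e2 := (EuclideanSpace.proj (𝕜 := ℝ) i).integral_comp_comm hi2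
  simp only [PiLp.proj_apply, PiLp.smul_apply, smul_eq_mul] at e1 e2
  rw [← e1, ← e2]
  -- The multiplier contains a component of the normal and is only Borel, so `hswap` is needed
  -- beyond continuous functions.
  have h3 := hswap (fun x ↦ φ x * ν x i) C (hφm.mul ((EuclideanSpace.proj
    (𝕜 := ℝ) i).continuous.measurable.comp hν)) (fun x ↦ by
      rw [abs_mul]
      exact (mul_le_of_le_one_right (abs_nonneg _)
        ((PiLp.norm_apply_le (ν x) i).trans (hν1 x))).trans (hC x))
  have h4 : ∫ x, φ x * g₀ x * ν x i ∂σ = ∫ x, φ x * ν x i * g₀ x ∂σ := by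
    congr 1; ext x; ring
  rw [h4, h3]
  refine integral_congr_ae ?_
  filter_upwards [hpν] with x hx
  conv_lhs => rw [hx]
  simp only [PiLp.smul_apply, smul_eq_mul]
  ring

/-- The total variation of the derivative on the boundary is given by the modulus of any trace. -/
theorem IsTrace.withDensity_eq (hΩ : IsOpen Ω) (hΩb : Bornology.IsBounded Ω)
    (hΩL : HasLipschitzBoundary Ω) (hu : u ∈ A0 Ω) {g : E → ℝ} (hg : IsTrace Ω u g) :
    (μHE[n - 1].restrict (frontier Ω)).withDensity (fun x ↦ ‖g x‖ₑ) =
      (bvDeriv u).variation.restrict (frontier Ω) := by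
  have hD := isDerivMeasure_bvDeriv hu.1
  have := hD.1
  have hfm : MeasurableSet (frontier Ω) := isClosed_frontier.measurableSet
  obtain ⟨hfin, hνm, hν1⟩ := measure_frontier_lt_top_and hΩ hΩb hΩL
  set σ := (μHE[n - 1] : Measure E).restrict (frontier Ω) with hσ
  have hgν : Integrable (fun x ↦ g x • outerNormal Ω x) σ :=
    Integrable.smul_bdd hg.1 1 hνm (ae_of_all _ norm_outerNormal_le)
  have hvar := Measure.variation_withDensityᵥ hgν
  have hfinv : IsFiniteMeasure (σ.withDensityᵥ fun x ↦ g x • outerNormal Ω x).variation := by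
    rw [hvar]; exact ⟨by simpa using! hgν.2⟩
  have hfin' : IsFiniteMeasure (-((bvDeriv u).restrict (frontier Ω))).variation := by
    rw [VectorMeasure.variation_neg]; infer_instance
  -- The trace identity says that `g ν ds` and `-Du` on `∂Ω` have the same integrals against test
  -- functions. Equality of the measures passes to variations, and `‖ν‖ = 1` a.e.
  have heq : σ.withDensityᵥ (fun x ↦ g x • outerNormal Ω x) =
      -((bvDeriv u).restrict (frontier Ω)) := by
    refine eq_of_integral_contDiff_eq fun φ hφ hc ↦ ?_
    have h1 : ContDiff ℝ 1 φ := hφ.of_le (by exact_mod_cast le_top)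
    obtain ⟨C, hC⟩ := exists_abs_le_of_hasCompactSupport hφ.continuous hc
    rw [integral_withDensityᵥ_lsmul hgν hφ.continuous.measurable hC,
      VectorMeasure.integral_neg_vectorMeasure, ← integral_gradient_add_eq hΩ hu h1 hc,
      hg.2 φ h1 hc]
    simp_rw [smul_smul]
    rfl
  rw [heq, VectorMeasure.variation_neg, VectorMeasure.variation_restrict hfm] at hvar
  rw [hvar]
  refine withDensity_congr_ae ?_
  filter_upwards [hν1] with x hx
  rw [enorm_smul, ← ofReal_norm (outerNormal Ω x), hx, ENNReal.ofReal_one, mul_one]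

/-- The vector measure `Du + F dx`, where `F` is considered on `Ω`. -/
def shiftedDeriv (Ω : Set E) (F : E → E) (u : E → ℝ) : VectorMeasure E E :=
  bvDeriv u + (volume.restrict Ω).withDensityᵥ F

lemma isFiniteMeasure_variation_withDensityᵥ {F : E → E} (hF : IntegrableOn F Ω) :
    IsFiniteMeasure ((volume.restrict Ω).withDensityᵥ F).variation := by
  rw [Measure.variation_withDensityᵥ hF]; exact ⟨by simpa using! hF.2⟩

lemma isFiniteMeasure_variation_shiftedDeriv {F : E → E} (hF : IntegrableOn F Ω) (hu : IsBV u) :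
    IsFiniteMeasure (shiftedDeriv Ω F u).variation := by
  have := (isDerivMeasure_bvDeriv hu).1
  have := isFiniteMeasure_variation_withDensityᵥ hF
  exact isFiniteMeasure_of_le _ VectorMeasure.variation_add_le

/-- The relaxed functional as the total variation of `Du + F dx` on the closure of `Ω`. -/
theorem relaxedEnergy_eq (hΩ : IsOpen Ω) (hΩb : Bornology.IsBounded Ω)
    (hΩL : HasLipschitzBoundary Ω) (hu : u ∈ A0 Ω) {F : E → E} (hF : IntegrableOn F Ω)
    {a b : E → ℝ} (hb : Measurable b) {M : ℝ} (hbM : ∀ x, |b x| ≤ M)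
    (hab : ∀ x ∈ closure Ω, a x = b x) (H : E → ℝ) :
    relaxedEnergy Ω a F H u =
      ∫ x, b x ∂(shiftedDeriv Ω F u).variation + ∫ x in Ω, H x * u x := by
  have hD := isDerivMeasure_bvDeriv hu.1
  have := hD.1
  have hfm : MeasurableSet (frontier Ω) := isClosed_frontier.measurableSet
  have := isFiniteMeasure_variation_shiftedDeriv hF hu.1
  have := isFiniteMeasure_variation_withDensityᵥ hF
  set V := shiftedDeriv Ω F u with hV
  have hdisj : Disjoint Ω (frontier Ω) := by
    rw [hΩ.frontier_eq]; exact disjoint_sdiff_right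
  have hcl : Ω ∪ frontier Ω = closure Ω := by
    rw [hΩ.frontier_eq, union_sdiff_cancel subset_closure]
  have hbi : Integrable b V.variation := Integrable.of_bound hb.aestronglyMeasurable M
    (ae_of_all _ hbM)
  have hFr : ∀ s, MeasurableSet s → (volume.restrict Ω).withDensityᵥ F (s ∩ Ω) =
      (volume.restrict Ω).withDensityᵥ F s := fun s hs ↦ by
    rw [withDensityᵥ_apply hF (hs.inter hΩ.measurableSet), withDensityᵥ_apply hF hs,
      Measure.restrict_restrict (hs.inter hΩ.measurableSet), Measure.restrict_restrict hs,
      inter_assoc, inter_self]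
  have h1 : (bvDeriv u).restrict Ω + (volume.restrict Ω).withDensityᵥ F = V.restrict Ω := by
    ext1 s hs
    rw [_root_.add_apply, VectorMeasure.restrict_apply _ hΩ.measurableSet hs,
      VectorMeasure.restrict_apply _ hΩ.measurableSet hs, hV, shiftedDeriv,
      _root_.add_apply, hFr s hs]
  have h2 : V.restrict (frontier Ω) = (bvDeriv u).restrict (frontier Ω) := by
    ext1 s hs
    rw [VectorMeasure.restrict_apply _ hfm hs, VectorMeasure.restrict_apply _ hfm hs, hV,
      shiftedDeriv, _root_.add_apply, ← hFr _ (hs.inter hfm)]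
    have : s ∩ frontier Ω ∩ Ω = ∅ := by
      rw [inter_assoc, inter_comm (frontier Ω), hdisj.inter_eq, inter_empty]
    rw [this, VectorMeasure.empty, add_zero]
  have h3 : V.variation (closure Ω)ᶜ = 0 := by
    refine le_antisymm ?_ zero_le
    refine (VectorMeasure.variation_add_le _).trans ?_
    rw [Measure.add_apply, variation_closure_compl_eq_zero hu, zero_add,
      Measure.variation_withDensityᵥ hF, withDensity_apply _ isClosed_closure.measurableSet.compl,
      Measure.restrict_restrict isClosed_closure.measurableSet.compl]
    have : (closure Ω)ᶜ ∩ Ω = ∅ := by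
      ext x; simp only [mem_inter_iff, mem_compl_iff, mem_empty_iff_false, iff_false, not_and]
      exact fun h h' ↦ h (subset_closure h')
    simp [this]
  -- `bvTrace` is a chosen trace with default value `0`; existence of a trace excludes the default.
  have htr : IsTrace Ω u (bvTrace Ω u) := by
    have hex := exists_isTrace hΩ hΩb hΩL hu
    rw [bvTrace, dif_pos hex]; exact hex.choose_spec
  have h4 : ∫ x in frontier Ω, a x * |bvTrace Ω u x| ∂μHE[n - 1] =
      ∫ x in frontier Ω, b x ∂V.variation := by
    rw [← VectorMeasure.variation_restrict hfm, h2, VectorMeasure.variation_restrict hfm,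
      ← htr.withDensity_eq hΩ hΩb hΩL hu, integral_withDensity_eq_integral_toReal_smul₀
      htr.1.aestronglyMeasurable.enorm (ae_of_all _ fun x ↦ by simp)]
    refine setIntegral_congr_fun hfm fun x hx ↦ ?_
    simp only [toReal_enorm, smul_eq_mul, Real.norm_eq_abs]
    rw [hab x (frontier_subset_closure hx), mul_comm]
  have h5 : ∫ x, a x ∂((bvDeriv u).restrict Ω + (volume.restrict Ω).withDensityᵥ F).variation =
      ∫ x in Ω, b x ∂V.variation := by
    rw [h1, VectorMeasure.variation_restrict hΩ.measurableSet]
    exact setIntegral_congr_fun hΩ.measurableSet fun x hx ↦ hab x (subset_closure hx)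
  have h6 : ∫ x, b x ∂V.variation = ∫ x in Ω, b x ∂V.variation +
      ∫ x in frontier Ω, b x ∂V.variation := by
    rw [← setIntegral_union hdisj hfm hbi.integrableOn hbi.integrableOn, hcl,
      ← integral_add_compl isClosed_closure.measurableSet hbi, Measure.restrict_eq_zero.2 h3]
    simp
  rw [relaxedEnergy, h4, h5, h6]
  ring

end Energy

/-! ### Vague compactness of measures -/

section Compactness

variable {n : ℕ} {ι : Type*} (𝒰 : Ultrafilter ι)

local notation "E" => EuclideanSpace ℝ (Fin n)

/-- Along an ultrafilter every bounded real family converges. This replaces the extraction of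
diagonal subsequences in all compactness arguments below. -/
lemma exists_tendsto_of_abs_le {x : ι → ℝ} {C : ℝ} (hx : ∀ k, |x k| ≤ C) :
    ∃ l, Tendsto x 𝒰 (𝓝 l) := by
  have h1 : ((𝒰.map x : Ultrafilter ℝ) : Filter ℝ) ≤ 𝓟 (Icc (-C) C) := by
    exact tendsto_principal.2 (Eventually.of_forall fun k ↦ abs_le.1 (hx k))
  obtain ⟨l, -, hl⟩ := isCompact_Icc.ultrafilter_le_nhds _ h1
  exact ⟨l, hl⟩

open scoped CompactlySupported in
/-- Compactness of bounded families of finite measures with respect to vague convergence along an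
ultrafilter. -/
theorem exists_measure_tendsto {m : ι → Measure E} [∀ k, IsFiniteMeasure (m k)] {C : ℝ}
    (hC : ∀ k, (m k).real univ ≤ C) :
    ∃ μ : Measure E, IsFiniteMeasure μ ∧ ∀ φ : E → ℝ, Continuous φ → HasCompactSupport φ →
      Tendsto (fun k ↦ ∫ x, φ x ∂(m k)) 𝒰 (𝓝 (∫ x, φ x ∂μ)) := by
  have hbd : ∀ (φ : E → ℝ) (c : ℝ), 0 ≤ c → (∀ x, |φ x| ≤ c) →
      ∀ k, |∫ x, φ x ∂(m k)| ≤ c * C := fun φ c hc hφ k ↦ by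
    rw [← Real.norm_eq_abs]
    refine (norm_integral_le_of_norm_le_const (C := c) (ae_of_all _ hφ)).trans ?_
    exact mul_le_mul_of_nonneg_left (hC k) hc
  have hex : ∀ φ : C_c(E, ℝ), ∃ l, Tendsto (fun k ↦ ∫ x, φ x ∂(m k)) 𝒰 (𝓝 l) := fun φ ↦ by
    obtain ⟨c, hc⟩ := exists_abs_le_of_hasCompactSupport φ.continuous φ.hasCompactSupport
    exact exists_tendsto_of_abs_le 𝒰 (hbd φ c ((abs_nonneg _).trans (hc 0)) hc)
  choose L hL using hex
  have hi : ∀ (φ : C_c(E, ℝ)) k, Integrable φ (m k) := fun φ k ↦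
    integrable_of_hasCompactSupport φ.continuous φ.hasCompactSupport (m k)
  let Λ₀ : C_c(E, ℝ) →ₗ[ℝ] ℝ :=
    { toFun := L
      map_add' := fun φ ψ ↦ by
        refine tendsto_nhds_unique (hL (φ + ψ)) ?_
        refine ((hL φ).add (hL ψ)).congr fun k ↦ ?_
        rw [← integral_add (hi φ k) (hi ψ k)]; rfl
      map_smul' := fun c φ ↦ by
        refine tendsto_nhds_unique (hL (c • φ)) ?_
        refine ((hL φ).const_mul c).congr fun k ↦ ?_
        rw [← integral_const_mul]; rfl }
  -- The limit functional is linear and positive, so the Riesz–Markov–Kakutani theorem represents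
  -- it. Mass may escape to infinity; only the bound of the total mass by `C` is claimed, obtained
  -- from compact sets by inner regularity.
  let Λ : C_c(E, ℝ) →ₚ[ℝ] ℝ := PositiveLinearMap.mk₀ Λ₀ fun φ hφ ↦
    ge_of_tendsto' (hL φ) fun k ↦ integral_nonneg fun x ↦ hφ x
  have hΛ : ∀ φ, Λ φ = L φ := fun φ ↦ rfl
  refine ⟨RealRMK.rieszMeasure Λ, ⟨?_⟩, fun φ hφ hc ↦ ?_⟩
  · refine lt_of_le_of_lt ?_ (ENNReal.ofReal_lt_top (r := C))
    rw [isOpen_univ.measure_eq_iSup_isCompact]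
    refine iSup₂_le fun K _ ↦ iSup_le fun hK ↦ ?_
    obtain ⟨f, hf1, -, hfc, hf01⟩ := exists_continuous_one_zero_of_isCompact hK isClosed_empty
      (disjoint_empty K)
    let g : C_c(E, ℝ) := ⟨f, hfc⟩
    have h1 := RealRMK.rieszMeasure_le_of_eq_one Λ (f := g) (fun x ↦ (hf01 x).1) hK
      (fun x hx ↦ hf1 hx)
    refine h1.trans (ENNReal.ofReal_le_ofReal ?_)
    rw [hΛ]
    refine le_of_tendsto' (hL g) fun k ↦ ?_
    have := hbd g 1 zero_le_one (fun x ↦ by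
      change |f x| ≤ 1
      rw [abs_of_nonneg (hf01 x).1]; exact (hf01 x).2) k
    rw [one_mul] at this
    exact (le_abs_self _).trans this
  · have := hL ⟨⟨φ, hφ⟩, hc⟩
    rw [← hΛ, ← RealRMK.integral_rieszMeasure Λ] at this
    exact this

/-- Integrals against a measure with a vector density, in terms of the positive and negative parts
of the components of the density. -/
lemma integral_smul_eq_sum {m : Measure E} [IsFiniteMeasure m] {q : E → E} (hqm : Measurable q)
    (hqi : Integrable q m) {φ : E → ℝ} (hφ : Measurable φ) {c : ℝ} (hcφ : ∀ x, |φ x| ≤ c) :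
    ∫ x, φ x • q x ∂m = ∑ i,
      (∫ x, φ x ∂(m.withDensity fun x ↦ ENNReal.ofReal ((if true then 1 else -1) * q x i)) -
        ∫ x, φ x ∂(m.withDensity fun x ↦ ENNReal.ofReal ((if false then 1 else -1) * q x i))) •
      EuclideanSpace.single i (1 : ℝ) := by
  have hint : Integrable (fun x ↦ φ x • q x) m :=
    hqi.bdd_smul c hφ.aestronglyMeasurable (ae_of_all _ hcφ)
  ext i
  have e1 : ∫ x, φ x * q x i ∂m = (∫ x, φ x • q x ∂m) i :=
    (EuclideanSpace.proj (𝕜 := ℝ) i).integral_comp_comm hint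
  rw [← e1]
  have hqc : Integrable (fun x ↦ q x i) m :=
    (EuclideanSpace.proj (𝕜 := ℝ) i).integrable_comp hqi
  have hqcm : Measurable (fun x ↦ q x i) :=
    (EuclideanSpace.proj (𝕜 := ℝ) i).continuous.measurable.comp hqm
  have e3 : ∀ t : ℝ, ∫ x, φ x ∂(m.withDensity fun x ↦ ENNReal.ofReal (t * q x i)) =
      ∫ x, max (t * q x i) 0 * φ x ∂m := fun t ↦ by
    rw [integral_withDensity_eq_integral_toReal_smul (hqcm.const_mul t).ennreal_ofReal
      (ae_of_all _ fun _ ↦ ENNReal.ofReal_lt_top)]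
    simp only [ENNReal.toReal_ofReal', smul_eq_mul]
  have e4 : ∀ t : ℝ, Integrable (fun x ↦ max (t * q x i) 0 * φ x) m := fun t ↦
    ((hqc.const_mul t).sup (integrable_zero _ _ _)).mul_bdd hφ.aestronglyMeasurable
      (ae_of_all _ hcφ)
  simp only [PiLp.smul_apply, PiLp.single_apply, smul_eq_mul, mul_ite,
    mul_one, mul_zero, Finset.sum_ite_eq, Finset.mem_univ, if_true, WithLp.ofLp_sum,
    Finset.sum_apply]
  rw [e3, e3, ← integral_sub (e4 _) (e4 _)]
  congr 1; ext x
  rw [← sub_mul]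
  simp only [one_mul, Bool.false_eq_true, if_false, neg_mul]
  rcases le_total 0 (q x i) with h | h
  · rw [max_eq_left h, max_eq_right (by linarith)]; ring
  · rw [max_eq_right h, max_eq_left (by linarith)]; ring

/-- Compactness of families of vector measures with bounded total variation. -/
theorem exists_vectorMeasure_tendsto {D : ι → VectorMeasure E E}
    [∀ k, IsFiniteMeasure (D k).variation] {C : ℝ} (hC : ∀ k, (D k).variation.real univ ≤ C) :
    ∃ D' : VectorMeasure E E, IsFiniteMeasure D'.variation ∧
      ∀ φ : E → ℝ, Continuous φ → HasCompactSupport φ →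
      Tendsto (fun k ↦ (D k).integral φ (ContinuousLinearMap.lsmul ℝ ℝ)) 𝒰
        (𝓝 (D'.integral φ (ContinuousLinearMap.lsmul ℝ ℝ))) := by
  choose q hqm hqi hqD using fun k ↦ exists_withDensityᵥ_variation_eq (D k)
  have hnorm : ∀ k, ∫⁻ x, ‖q k x‖ₑ ∂(D k).variation = (D k).variation univ := fun k ↦ by
    have h1 := Measure.variation_withDensityᵥ (hqi k)
    rw [hqD k] at h1
    conv_rhs => rw [h1]
    rw [withDensity_apply _ MeasurableSet.univ, Measure.restrict_univ]
  -- Positive and negative parts of the coordinates of `D k`, each of mass at most that of the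
  -- variation. This reduces the vector case to finite positive measures.
  let m : Bool → Fin n → ι → Measure E := fun s i k ↦
    (D k).variation.withDensity fun x ↦ ENNReal.ofReal ((if s then 1 else -1) * q k x i)
  have hle : ∀ s i k, m s i k univ ≤ (D k).variation univ := fun s i k ↦ by
    rw [withDensity_apply _ MeasurableSet.univ, Measure.restrict_univ, ← hnorm k]
    refine lintegral_mono fun x ↦ ?_
    rw [← ofReal_norm]
    refine ENNReal.ofReal_le_ofReal ((le_abs_self _).trans ?_)
    rw [abs_mul]
    have h1 : |(if s then (1 : ℝ) else -1)| = 1 := by cases s <;> simp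
    rw [h1, one_mul]
    exact PiLp.norm_apply_le (q k x) i
  have hfin : ∀ s i k, IsFiniteMeasure (m s i k) := fun s i k ↦
    ⟨(hle s i k).trans_lt (measure_lt_top _ _)⟩
  have hmC : ∀ s i k, (m s i k).real univ ≤ C := fun s i k ↦
    (ENNReal.toReal_mono (measure_ne_top _ _) (hle s i k)).trans (hC k)
  choose μ hμf hμ using fun s i ↦ exists_measure_tendsto 𝒰 (hmC s i)
  let b : Fin n → E := fun i ↦ EuclideanSpace.single i 1
  obtain ⟨Q, hQf, hQint⟩ : ∃ Q : Bool → Fin n → VectorMeasure E E,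
      (∀ s i, IsFiniteMeasure (Q s i).variation) ∧
      ∀ s i (φ : E → ℝ), Continuous φ → HasCompactSupport φ →
        (Q s i).integral φ (ContinuousLinearMap.lsmul ℝ ℝ) = (∫ x, φ x ∂(μ s i)) • b i := by
    have hQi : ∀ s i, Integrable (fun _ : E ↦ b i) (μ s i) := fun s i ↦ integrable_const _
    refine ⟨fun s i ↦ (μ s i).withDensityᵥ fun _ ↦ b i, fun s i ↦ ?_, fun s i φ hφ hc ↦ ?_⟩
    · rw [Measure.variation_withDensityᵥ (hQi s i)]
      exact isFiniteMeasure_withDensity (hQi s i).2.ne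
    · obtain ⟨c, hcφ⟩ := exists_abs_le_of_hasCompactSupport hφ hc
      rw [integral_withDensityᵥ_lsmul (hQi _ _) hφ.measurable hcφ, integral_smul_const]
  have hdf : ∀ i, IsFiniteMeasure (Q true i - Q false i).variation := fun i ↦
    isFiniteMeasure_of_le _ VectorMeasure.variation_sub_le
  refine ⟨∑ i, (Q true i - Q false i),
    isFiniteMeasure_of_le _ (VectorMeasure.variation_finsetSum_le _ _), fun φ hφ hc ↦ ?_⟩
  obtain ⟨c, hcφ⟩ := exists_abs_le_of_hasCompactSupport hφ hc
  have hlim : (∑ i, (Q true i - Q false i)).integral φ (ContinuousLinearMap.lsmul ℝ ℝ) =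
      ∑ i, (∫ x, φ x ∂(μ true i) - ∫ x, φ x ∂(μ false i)) • b i := by
    have hint : ∀ s i, (Q s i).Integrable φ := fun s i ↦
      integrable_of_hasCompactSupport hφ hc (Q s i).variation
    have hint' : ∀ i ∈ Finset.univ, (Q true i - Q false i).Integrable φ := fun i _ ↦
      integrable_of_hasCompactSupport hφ hc (Q true i - Q false i).variation
    rw [VectorMeasure.integral_finsetSum_vectorMeasure hint']
    refine Finset.sum_congr rfl fun i _ ↦ ?_
    rw [VectorMeasure.integral_sub_vectorMeasure (hint true i) (hint false i), sub_smul,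
      hQint _ _ φ hφ hc, hQint _ _ φ hφ hc]
  have hk : ∀ k, (D k).integral φ (ContinuousLinearMap.lsmul ℝ ℝ) =
      ∑ i, (∫ x, φ x ∂(m true i k) - ∫ x, φ x ∂(m false i k)) • b i := fun k ↦ by
    conv_lhs => rw [← hqD k]
    rw [integral_withDensityᵥ_lsmul (hqi k) hφ.measurable hcφ,
      integral_smul_eq_sum (hqm k) (hqi k) hφ.measurable hcφ]
  simp_rw [hk, hlim]
  exact tendsto_finsetSum _ fun i _ ↦ ((hμ true i φ hφ hc).sub (hμ false i φ hφ hc)).smul_const _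

end Compactness

/-! ### Equi-integrability from translations -/

section Equiintegrability

variable {n : ℕ} {u : EuclideanSpace ℝ (Fin n) → ℝ}
    {τ : Measure (EuclideanSpace ℝ (Fin n))} [IsFiniteMeasure τ]
    {p : EuclideanSpace ℝ (Fin n) → EuclideanSpace ℝ (Fin n)}

local notation "E" => EuclideanSpace ℝ (Fin n)

/-- Functions of bounded variation are equi-integrable in terms of their norm and total
variation. -/
theorem HasDerivDensity.volume_mul_abs_setIntegral_le (h : HasDerivDensity u τ p) {A : Set E}
    (hA : MeasurableSet A) {ε : ℝ} :
    volume (Metric.ball (0 : E) ε) *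
        ENNReal.ofReal (|∫ x in A, u x| - ε * ∫ x, ‖p x‖ ∂τ) ≤
      volume A * ∫⁻ x, ‖u x‖ₑ := by
  let w := h.integrable.aestronglyMeasurable.mk u
  have hw : Measurable w := h.integrable.aestronglyMeasurable.stronglyMeasurable_mk.measurable
  have huw : u =ᵐ[volume] w := h.integrable.aestronglyMeasurable.ae_eq_mk
  -- Replacing `u` by a translate of length below `ε` changes its integral over `A` by at most `ε
  -- |Du|`. Averaging over the ball and exchanging integrals leaves, for each point of `A`, at most
  -- the full `L¹` norm of `u`.
  have h1 : ∀ v ∈ Metric.ball (0 : E) ε,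
      ENNReal.ofReal (|∫ x in A, u x| - ε * ∫ x, ‖p x‖ ∂τ) ≤ ∫⁻ x in A, ‖w (x - v)‖ₑ := by
    intro v hv
    have hv' : ‖v‖ ≤ ε := by simpa using (Metric.mem_ball.1 hv).le
    have h2 := h.abs_integral_translate_le v (φ := A.indicator 1) (C := 1)
      (measurable_one.indicator hA) (fun x ↦ by by_cases hx : x ∈ A <;> simp [hx])
    have hiv := h.integrable.comp_sub_right v
    have h3 : ∫ x, A.indicator 1 x * (u (x - v) - u x) =
        (∫ x in A, u (x - v)) - ∫ x in A, u x := by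
      rw [← integral_sub hiv.integrableOn h.integrable.integrableOn, ← integral_indicator hA]
      congr 1; ext x; by_cases hx : x ∈ A <;> simp [hx]
    rw [h3, one_mul] at h2
    have h4 : |∫ x in A, u x| - ε * ∫ x, ‖p x‖ ∂τ ≤ |∫ x in A, u (x - v)| := by
      have h5 := abs_sub_abs_le_abs_sub (∫ x in A, u x) (∫ x in A, u (x - v))
      rw [abs_sub_comm] at h5
      have h6 : ‖v‖ * ∫ x, ‖p x‖ ∂τ ≤ ε * ∫ x, ‖p x‖ ∂τ :=
        mul_le_mul_of_nonneg_right hv' (integral_nonneg fun _ ↦ norm_nonneg _)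
      linarith
    refine (ENNReal.ofReal_le_ofReal h4).trans ?_
    rw [← Real.norm_eq_abs, ofReal_norm]
    refine (enorm_integral_le_lintegral_enorm _).trans (le_of_eq ?_)
    refine lintegral_congr_ae (ae_restrict_of_ae ?_)
    have := (measurePreserving_sub_right (volume : Measure E) v).quasiMeasurePreserving.ae huw
    filter_upwards [this] with x hx
    rw [hx]
  calc volume (Metric.ball (0 : E) ε) * ENNReal.ofReal (|∫ x in A, u x| - ε * ∫ x, ‖p x‖ ∂τ)
      = ∫⁻ _ in Metric.ball (0 : E) ε,
          ENNReal.ofReal (|∫ x in A, u x| - ε * ∫ x, ‖p x‖ ∂τ) := by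
        rw [setLIntegral_const, mul_comm]
    _ ≤ ∫⁻ v in Metric.ball (0 : E) ε, ∫⁻ x in A, ‖w (x - v)‖ₑ :=
        setLIntegral_mono' Metric.isOpen_ball.measurableSet h1
    _ = ∫⁻ x in A, ∫⁻ v in Metric.ball (0 : E) ε, ‖w (x - v)‖ₑ := by
        rw [lintegral_lintegral_swap]
        exact (Measurable.enorm (hw.comp (measurable_snd.sub measurable_fst))).aemeasurable
    _ ≤ ∫⁻ _ in A, ∫⁻ x, ‖u x‖ₑ := by
        refine lintegral_mono fun x ↦ (setLIntegral_le_lintegral _ _).trans (le_of_eq ?_)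
        rw [lintegral_sub_left_eq_self (fun y ↦ ‖w y‖ₑ) x]
        refine lintegral_congr_ae ?_
        filter_upwards [huw] with y hy
        rw [hy]
    _ = volume A * ∫⁻ x, ‖u x‖ₑ := by rw [setLIntegral_const, mul_comm]

end Equiintegrability

/-! ### Weak compactness in `L¹` -/

section WeakCompactness

variable {X ι : Type*} [MeasurableSpace X] {μ : Measure X} [IsFiniteMeasure μ] (𝒰 : Ultrafilter ι)

/-- Setwise limits of bounded equi-integrable families are signed measures. -/
lemma exists_signedMeasure_tendsto {f : ι → X → ℝ} (hf : ∀ k, Integrable (f k) μ) {C : ℝ}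
    (hC : ∀ k, ∫ x, |f k x| ∂μ ≤ C)
    (hac : ∀ ε > 0, ∃ δ > 0, ∀ k, ∀ A, MeasurableSet A → μ A ≤ δ → |∫ x in A, f k x ∂μ| ≤ ε) :
    ∃ s : SignedMeasure X, ∀ A, MeasurableSet A →
      Tendsto (fun k ↦ ∫ x in A, f k x ∂μ) 𝒰 (𝓝 (s A)) := by
  classical
  have hex : ∀ A : Set X, ∃ l, Tendsto (fun k ↦ ∫ x in A, f k x ∂μ) 𝒰 (𝓝 l) := fun A ↦ by
    refine exists_tendsto_of_abs_le 𝒰 (C := C) fun k ↦ ?_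
    refine abs_integral_le_integral_abs.trans (le_trans ?_ (hC k))
    exact setIntegral_le_integral (hf k).abs (ae_of_all _ fun _ ↦ abs_nonneg _)
  choose L hL using hex
  -- The limit set function inherits the uniform absolute continuity. This upgrades finite to
  -- countable additivity, since the tails of a disjoint union have small measure.
  have hLac : ∀ ε > 0, ∃ δ > 0, ∀ A, MeasurableSet A → μ A ≤ δ → |L A| ≤ ε := fun ε hε ↦ by
    obtain ⟨δ, hδ, h⟩ := hac ε hε
    exact ⟨δ, hδ, fun A hA hμA ↦ le_of_tendsto' (hL A).abs fun k ↦ h k A hA hμA⟩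
  have hLu : ∀ A B, MeasurableSet A → MeasurableSet B → Disjoint A B →
      L (A ∪ B) = L A + L B := fun A B _ hB hAB ↦ by
    refine tendsto_nhds_unique (hL (A ∪ B)) (((hL A).add (hL B)).congr fun k ↦ ?_)
    rw [setIntegral_union hAB hB (hf k).integrableOn (hf k).integrableOn]
  have hL0 : L ∅ = 0 := tendsto_nhds_unique (hL ∅) (by simp)
  have hLs : ∀ (A : ℕ → Set X), (∀ i, MeasurableSet (A i)) → Pairwise (Function.onFun Disjoint A) →
      ∀ t : Finset ℕ, L (⋃ i ∈ t, A i) = ∑ i ∈ t, L (A i) := fun A hA hd t ↦ by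
    induction t using Finset.induction_on with
    | empty => simpa using hL0
    | insert i t hi ih =>
      rw [Finset.set_biUnion_insert, hLu _ _ (hA i) (t.measurableSet_biUnion fun j _ ↦ hA j),
        ih, Finset.sum_insert hi]
      rw [disjoint_iUnion₂_right]
      exact fun j hj ↦ hd fun h ↦ hi (h ▸ hj)
  refine ⟨⟨fun A ↦ if MeasurableSet A then L A else 0, by simp [hL0], fun A hA ↦ if_neg hA,
    fun A hA hd ↦ ?_⟩, fun A hA ↦ ?_⟩
  · simp only [hA, MeasurableSet.iUnion hA, if_true]
    rw [HasSum, SummationFilter.unconditional_filter, Metric.tendsto_nhds]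
    intro ε hε
    obtain ⟨δ, hδ, h⟩ := hLac (ε / 2) (half_pos hε)
    have hfin : ∑' i, μ (A i) ≠ ⊤ := by
      rw [← measure_iUnion hd hA]; exact measure_ne_top μ _
    have htail := (ENNReal.tendsto_tsum_compl_atTop_zero hfin).eventually_lt_const hδ
    filter_upwards [htail] with t ht
    have hm1 : MeasurableSet (⋃ i ∈ t, A i) := t.measurableSet_biUnion fun j _ ↦ hA j
    have hm2 : MeasurableSet (⋃ i : {i // i ∉ t}, A i) := MeasurableSet.iUnion fun i ↦ hA i
    have hun : ⋃ i, A i = (⋃ i ∈ t, A i) ∪ ⋃ i : {i // i ∉ t}, A i := by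
      ext x
      simp only [mem_union, mem_iUnion, exists_prop, Subtype.exists]
      constructor
      · rintro ⟨i, hi⟩
        by_cases h : i ∈ t
        exacts [Or.inl ⟨i, h, hi⟩, Or.inr ⟨i, h, hi⟩]
      · rintro (⟨i, -, hi⟩ | ⟨i, -, hi⟩) <;> exact ⟨i, hi⟩
    have hdis : Disjoint (⋃ i ∈ t, A i) (⋃ i : {i // i ∉ t}, A i) := by
      rw [disjoint_iUnion₂_left]
      intro i hi
      rw [disjoint_iUnion_right]
      exact fun j ↦ hd fun h ↦ j.2 (h ▸ hi)
    have h1 := h _ hm2 ((measure_iUnion_le _).trans ht.le)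
    rw [hun, hLu _ _ hm1 hm2 hdis, hLs A hA hd, dist_comm, Real.dist_eq, add_sub_cancel_left]
    linarith
  · change Tendsto _ _ (𝓝 (if MeasurableSet A then L A else 0))
    rw [if_pos hA]
    exact hL A

/-- Uniform approximation of bounded measurable functions by simple functions. -/
lemma exists_simpleFunc_abs_sub_le {b : X → ℝ} (hb : Measurable b) {M : ℝ} (hM : ∀ x, |b x| ≤ M)
    {ε : ℝ} (hε : 0 < ε) : ∃ g : SimpleFunc X ℝ, ∀ x, |b x - g x| ≤ ε := by
  have hm : Measurable fun x ↦ ⌊b x / ε⌋ := (hb.div_const ε).floor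
  have hfin : (range fun x ↦ ⌊b x / ε⌋).Finite := by
    refine (finite_Icc ⌊-M / ε⌋ ⌊M / ε⌋).subset ?_
    rintro _ ⟨x, rfl⟩
    have := abs_le.1 (hM x)
    exact ⟨Int.floor_le_floor (by gcongr; exact this.1), Int.floor_le_floor (by gcongr; exact this.2)⟩
  let g₀ : SimpleFunc X ℤ := ⟨fun x ↦ ⌊b x / ε⌋, fun y ↦ hm (measurableSet_singleton y), hfin⟩
  refine ⟨g₀.map fun z : ℤ ↦ ε * (z : ℝ), fun x ↦ ?_⟩
  change |b x - ε * (⌊b x / ε⌋ : ℝ)| ≤ ε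
  have h1 : b x = ε * (b x / ε) := by field_simp
  have h2 : b x - ε * (⌊b x / ε⌋ : ℝ) = ε * Int.fract (b x / ε) := by
    rw [Int.fract, mul_sub, ← h1]
  rw [h2, abs_of_nonneg (mul_nonneg hε.le (Int.fract_nonneg _))]
  exact mul_le_of_le_one_right hε.le (Int.fract_lt_one _).le

/-- Weak sequential compactness in `L¹` (Dunford–Pettis), along an ultrafilter. -/
theorem exists_weak_limit {f : ι → X → ℝ} (hf : ∀ k, Integrable (f k) μ) {C : ℝ}
    (hC : ∀ k, ∫ x, |f k x| ∂μ ≤ C)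
    (hac : ∀ ε > 0, ∃ δ > 0, ∀ k, ∀ A, MeasurableSet A → μ A ≤ δ → |∫ x in A, f k x ∂μ| ≤ ε) :
    ∃ g : X → ℝ, Integrable g μ ∧ ∀ b : X → ℝ, Measurable b → ∀ M : ℝ, (∀ x, |b x| ≤ M) →
      Tendsto (fun k ↦ ∫ x, b x * f k x ∂μ) 𝒰 (𝓝 (∫ x, b x * g x ∂μ)) := by
  obtain ⟨s, hs⟩ := exists_signedMeasure_tendsto 𝒰 hf hC hac
  have hsμ : s ≪ᵥ μ.toENNRealVectorMeasure := by
    refine VectorMeasure.AbsolutelyContinuous.mk fun A hA h ↦ ?_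
    rw [Measure.toENNRealVectorMeasure_apply_measurable hA] at h
    refine tendsto_nhds_unique (hs A hA) ?_
    simp [Measure.restrict_eq_zero.2 h]
  have hg := SignedMeasure.integrable_rnDeriv s μ
  have hsg := SignedMeasure.withDensityᵥ_rnDeriv_eq s μ hsμ
  set g := s.rnDeriv μ with hgdef
  have hsA : ∀ A, MeasurableSet A → s A = ∫ x in A, g x ∂μ := fun A hA ↦ by
    rw [← withDensityᵥ_apply hg hA, hsg]
  have hsi : ∀ (φ : SimpleFunc X ℝ) {h : X → ℝ}, Integrable h μ →
      Integrable (fun x ↦ φ x * h x) μ := fun φ h hh ↦ by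
    obtain ⟨c, hc⟩ := φ.exists_forall_norm_le
    exact hh.bdd_mul φ.measurable.aestronglyMeasurable (ae_of_all _ hc)
  have hsimple : ∀ φ : SimpleFunc X ℝ,
      Tendsto (fun k ↦ ∫ x, φ x * f k x ∂μ) 𝒰 (𝓝 (∫ x, φ x * g x ∂μ)) := fun φ ↦ by
    induction φ using SimpleFunc.induction with
    | @const c A hA =>
      have : ∀ h : X → ℝ, ∫ x, (SimpleFunc.piecewise A hA (SimpleFunc.const _ c)
          (SimpleFunc.const _ 0)) x * h x ∂μ = c * ∫ x in A, h x ∂μ := fun h ↦ by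
        rw [← integral_const_mul, ← integral_indicator hA]
        congr 1; ext x
        by_cases hx : x ∈ A <;> simp [hx]
      simp_rw [this, ← hsA A hA]
      exact (hs A hA).const_mul c
    | @add φ ψ _ h1 h2 =>
      have : ∀ h : X → ℝ, Integrable h μ → ∫ x, (φ + ψ) x * h x ∂μ =
          ∫ x, φ x * h x ∂μ + ∫ x, ψ x * h x ∂μ := fun h hh ↦ by
        rw [← integral_add (hsi φ hh) (hsi ψ hh)]
        simp [add_mul]
      rw [this g hg]
      exact (h1.add h2).congr fun k ↦ (this _ (hf k)).symm
  refine ⟨g, hg, fun b hb M hM ↦ ?_⟩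
  have hbi : ∀ {h : X → ℝ}, Integrable h μ → Integrable (fun x ↦ b x * h x) μ := fun hh ↦
    hh.bdd_mul hb.aestronglyMeasurable (ae_of_all _ hM)
  rw [Metric.tendsto_nhds]
  intro ε hε
  -- `K` collects the `L¹` bounds of the family and of the limit, plus one for the simple-function
  -- error, so the three contributions sum to `ε / 2`.
  obtain ⟨K, hKdef⟩ : ∃ K, K = |C| + ∫ x, |g x| ∂μ + 1 := ⟨_, rfl⟩
  have hg0 : 0 ≤ ∫ x, |g x| ∂μ := integral_nonneg fun _ ↦ abs_nonneg _
  have hK : 0 < K := by rw [hKdef]; positivity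
  obtain ⟨φ, hφ⟩ := exists_simpleFunc_abs_sub_le hb hM (ε := ε / 2 / K) (by positivity)
  have hdiff : ∀ h : X → ℝ, Integrable h μ →
      |∫ x, b x * h x ∂μ - ∫ x, φ x * h x ∂μ| ≤ ε / 2 / K * ∫ x, |h x| ∂μ := fun h hh ↦ by
    rw [← integral_sub (hbi hh) (hsi φ hh), ← integral_const_mul, ← Real.norm_eq_abs]
    refine norm_integral_le_of_norm_le (hh.abs.const_mul _) (ae_of_all _ fun x ↦ ?_)
    rw [← sub_mul, norm_mul]
    exact mul_le_mul_of_nonneg_right (hφ x) (abs_nonneg _)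
  filter_upwards [Metric.tendsto_nhds.1 (hsimple φ) (ε / 2 / K) (by positivity)] with k hk
  rw [Real.dist_eq] at hk ⊢
  have h1 := hdiff _ (hf k)
  have h2 := hdiff g hg
  have h3 : ε / 2 / K * ∫ x, |f k x| ∂μ ≤ ε / 2 / K * |C| :=
    mul_le_mul_of_nonneg_left ((hC k).trans (le_abs_self C)) (by positivity)
  have h4 : ε / 2 / K * |C| + ε / 2 / K * ∫ x, |g x| ∂μ + ε / 2 / K = ε / 2 := by
    have : ε / 2 / K * K = ε / 2 := by field_simp
    rw [← mul_add, ← mul_add_one, ← hKdef, this]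
  rw [abs_le] at h1 h2
  rw [abs_lt] at hk ⊢
  constructor <;> linarith [h1.1, h1.2, h2.1, h2.2, hk.1, hk.2]

end WeakCompactness

/-! ### Lower semicontinuity under vague convergence -/

section Semicontinuity

variable {ι : Type*} (𝒰 : Ultrafilter ι)

/-- A bounded nonnegative lower semicontinuous function is a pointwise limit of continuous
functions with values between `0` and the function. -/
lemma LowerSemicontinuous.exists_continuous_tendsto {X : Type*} [PseudoMetricSpace X] {b : X → ℝ}
    (hb : LowerSemicontinuous b) (hb0 : ∀ x, 0 ≤ b x) :
    ∃ g : ℕ → X → ℝ, (∀ j, Continuous (g j)) ∧ (∀ j x, 0 ≤ g j x ∧ g j x ≤ b x) ∧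
      ∀ x, Tendsto (fun j ↦ g j x) atTop (𝓝 (b x)) := by
  -- The inf-convolution with `j * dist` is `j`-Lipschitz, lies below `b`, and converges to `b` by
  -- lower semicontinuity.
  let g : ℕ → X → ℝ := fun j x ↦ ⨅ y, (b y + j * dist x y)
  have hbdd : ∀ (j : ℕ) x, BddBelow (range fun y ↦ b y + (j : ℝ) * dist x y) := fun j x ↦
    ⟨0, by rintro _ ⟨y, rfl⟩; exact add_nonneg (hb0 y) (mul_nonneg j.cast_nonneg dist_nonneg)⟩
  have hle : ∀ j x y, g j x ≤ b y + j * dist x y := fun j x y ↦ ciInf_le (hbdd j x) y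
  have h0 : ∀ j x, 0 ≤ g j x := fun j x ↦
    Real.iInf_nonneg fun y ↦ add_nonneg (hb0 y) (mul_nonneg j.cast_nonneg dist_nonneg)
  have hgb : ∀ j x, g j x ≤ b x := fun j x ↦ by simpa using hle j x x
  refine ⟨g, fun j ↦ ?_, fun j x ↦ ⟨h0 j x, hgb j x⟩, fun x ↦ ?_⟩
  · refine (LipschitzWith.of_le_add_mul (j : ℝ≥0) fun x y ↦ ?_).continuous
    have : Nonempty X := ⟨x⟩
    rw [← sub_le_iff_le_add]
    refine le_ciInf fun z ↦ ?_
    have h1 := hle j x z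
    have h2 := mul_le_mul_of_nonneg_left (dist_triangle x y z) (Nat.cast_nonneg (α := ℝ) j)
    simp only [NNReal.coe_natCast]
    linarith
  · have : Nonempty X := ⟨x⟩
    rw [tendsto_order]
    refine ⟨fun c hc ↦ ?_, fun c hc ↦ Eventually.of_forall fun j ↦ (hgb j x).trans_lt hc⟩
    obtain ⟨c', hcc', hc'⟩ := exists_between hc
    obtain ⟨r, hr, hball⟩ := Metric.eventually_nhds_iff.1 (hb x c' hc')
    obtain ⟨N, hN⟩ := exists_nat_gt (c' / r)
    filter_upwards [eventually_ge_atTop N] with j hj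
    refine hcc'.trans_le (le_ciInf fun y ↦ ?_)
    rcases lt_or_ge (dist y x) r with h | h
    · have := hball h
      have : 0 ≤ (j : ℝ) * dist x y := by positivity
      linarith
    · have h1 : c' < N * r := (div_lt_iff₀ hr).1 hN
      have h2 : (N : ℝ) * r ≤ j * dist x y := by
        rw [dist_comm]
        exact mul_le_mul (by exact_mod_cast hj) h hr.le (Nat.cast_nonneg _)
      have := hb0 y
      linarith

variable {n : ℕ}

local notation "E" => EuclideanSpace ℝ (Fin n)

/-- Lower semicontinuity of integrals of lower semicontinuous functions with respect to vague
convergence. -/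
theorem integral_le_of_tendsto {m : ι → Measure E} [∀ k, IsFiniteMeasure (m k)] {lam : Measure E}
    [IsFiniteMeasure lam] (hm : ∀ φ : E → ℝ, Continuous φ → HasCompactSupport φ →
      Tendsto (fun k ↦ ∫ x, φ x ∂(m k)) 𝒰 (𝓝 (∫ x, φ x ∂lam)))
    {b : E → ℝ} (hb : LowerSemicontinuous b) (hb0 : ∀ x, 0 ≤ b x) {M : ℝ} (hbM : ∀ x, b x ≤ M)
    {c : ℝ} (hc : Tendsto (fun k ↦ ∫ x, b x ∂(m k)) 𝒰 (𝓝 c)) :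
    ∫ x, b x ∂lam ≤ c := by
  obtain ⟨g, hgc, hgb, hg⟩ := LowerSemicontinuous.exists_continuous_tendsto hb hb0
  -- Vague convergence only sees compact supports, so the approximants are also cut off at radius `j
  -- + 1`.
  let χ : ℕ → E → ℝ := fun j x ↦ max 0 (min 1 (j + 1 - ‖x‖))
  have hχc : ∀ j, Continuous (χ j) := fun j ↦ by fun_prop
  have hχ0 : ∀ j x, 0 ≤ χ j x := fun j x ↦ le_max_left _ _
  have hχ1 : ∀ j x, χ j x ≤ 1 := fun j x ↦ max_le zero_le_one (min_le_left _ _)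
  have hχs : ∀ j, HasCompactSupport (χ j) := fun j ↦ by
    refine HasCompactSupport.intro (isCompact_closedBall (0 : E) (j + 1)) fun x hx ↦ ?_
    rw [Metric.mem_closedBall, dist_zero_right, not_le] at hx
    exact max_eq_left ((min_le_right _ _).trans (by linarith))
  have hχt : ∀ x, ∀ᶠ j in atTop, χ j x = 1 := fun x ↦ by
    obtain ⟨N, hN⟩ := exists_nat_gt ‖x‖
    filter_upwards [eventually_ge_atTop N] with j hj
    have : (N : ℝ) ≤ j := by exact_mod_cast hj
    simp only [χ]
    rw [min_eq_left (by linarith), max_eq_right zero_le_one]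
  have hle : ∀ j x, χ j x * g j x ≤ b x := fun j x ↦
    (mul_le_of_le_one_left (hgb j x).1 (hχ1 j x)).trans (hgb j x).2
  have hbi : ∀ (μ : Measure E) [IsFiniteMeasure μ], Integrable b μ := fun μ _ ↦
    Integrable.of_bound hb.measurable.aestronglyMeasurable M (ae_of_all _ fun x ↦ by
      rw [Real.norm_eq_abs, abs_of_nonneg (hb0 x)]; exact hbM x)
  have hint : ∀ j, ∫ x, χ j x * g j x ∂lam ≤ c := fun j ↦ by
    have hcc : Continuous fun x ↦ χ j x * g j x := (hχc j).mul (hgc j)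
    have hcs : HasCompactSupport fun x ↦ χ j x * g j x := (hχs j).mul_right
    refine le_of_tendsto_of_tendsto' (hm _ hcc hcs) hc fun k ↦ ?_
    exact integral_mono (integrable_of_hasCompactSupport hcc hcs _) (hbi _) (hle j)
  refine le_of_tendsto' (tendsto_integral_of_dominated_convergence (μ := lam) (fun _ ↦ M)
    (fun j ↦ ((hχc j).mul (hgc j)).aestronglyMeasurable) (integrable_const _)
    (fun j ↦ ae_of_all _ fun x ↦ ?_) (ae_of_all _ fun x ↦ ?_)) hint
  · rw [Real.norm_eq_abs, Pi.mul_apply, abs_of_nonneg (mul_nonneg (hχ0 j x) (hgb j x).1)]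
    exact (hle j x).trans (hbM x)
  · refine (hg x).congr' ?_
    filter_upwards [hχt x] with j hj
    simp [hj]

end Semicontinuity

/-! ### The direct method -/

section Existence

variable {n : ℕ} {Ω : Set (EuclideanSpace ℝ (Fin n))}

local notation "E" => EuclideanSpace ℝ (Fin n)

lemma exists_forall_abs_setIntegral_le (C T : ℝ) {ε : ℝ} (hε : 0 < ε) :
    ∃ δ > 0, ∀ u : E → ℝ, IsBV u → ∫ x, |u x| ≤ C → (bvDeriv u).variation.real univ ≤ T →
      ∀ A, MeasurableSet A → volume A ≤ δ → |∫ x in A, u x| ≤ ε := by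
  obtain ⟨r, hr, hrT⟩ : ∃ r > 0, r * T ≤ ε / 2 := by
    refine ⟨ε / 2 / (|T| + 1), by positivity, ?_⟩
    rw [div_mul_eq_mul_div, div_le_iff₀ (by positivity)]
    exact mul_le_mul_of_nonneg_left (by linarith [le_abs_self T]) (by positivity)
  have hV0 : volume (Metric.ball (0 : E) r) ≠ 0 := (Metric.measure_ball_pos volume _ hr).ne'
  have hVt : volume (Metric.ball (0 : E) r) ≠ ⊤ := measure_ball_lt_top.ne
  -- Chosen so that the equi-integrability estimate yields `|∫_A u| - r |Du| ≤ ε / 2`, while `r T ≤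
  -- ε / 2`. The added `1` keeps the denominator nonzero.
  refine ⟨volume (Metric.ball (0 : E) r) * ENNReal.ofReal (ε / 2) / (ENNReal.ofReal C + 1), ?_,
    fun u hu hC hT A hA hAδ ↦ ?_⟩
  · refine ENNReal.div_pos (mul_ne_zero hV0 ?_) (by simp)
    exact (ENNReal.ofReal_pos.2 (half_pos hε)).ne'
  have hD := isDerivMeasure_bvDeriv hu
  have := hD.1
  obtain ⟨p, hp, -, hpn⟩ := hD.exists_density hu.1
  have h1 := hp.volume_mul_abs_setIntegral_le hA (ε := r)
  have h2 : ∫⁻ x, ‖u x‖ₑ ≤ ENNReal.ofReal C + 1 := by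
    have : ∫⁻ x, ‖u x‖ₑ = ENNReal.ofReal (∫ x, |u x|) := by
      rw [← ofReal_integral_norm_eq_lintegral_enorm hu.1]; rfl
    rw [this]
    exact (ENNReal.ofReal_le_ofReal hC).trans le_self_add
  have h3 := h1.trans (mul_le_mul' hAδ h2)
  rw [ENNReal.div_mul_cancel (by simp) (by simp), ENNReal.mul_le_mul_iff_right hV0 hVt,
    ENNReal.ofReal_le_ofReal_iff (by positivity), hpn] at h3
  have h4 := mul_le_mul_of_nonneg_left hT hr.le
  linarith

/-- Compactness in `A₀` of sequences with bounded norm and total variation. -/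
theorem exists_limit_mem_A0 {ι : Type*} (𝒰 : Ultrafilter ι) (hΩ : IsOpen Ω)
    (hΩb : Bornology.IsBounded Ω) {u : ι → E → ℝ} (hu : ∀ k, u k ∈ A0 Ω) {C T : ℝ}
    (hC : ∀ k, ∫ x, |u k x| ≤ C) (hT : ∀ k, (bvDeriv (u k)).variation.real univ ≤ T) :
    ∃ w ∈ A0 Ω,
      (∀ φ : E → ℝ, Continuous φ → HasCompactSupport φ →
        Tendsto (fun k ↦ (bvDeriv (u k)).integral φ (ContinuousLinearMap.lsmul ℝ ℝ)) 𝒰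
          (𝓝 ((bvDeriv w).integral φ (ContinuousLinearMap.lsmul ℝ ℝ)))) ∧
      ∀ b : E → ℝ, Measurable b → ∀ M : ℝ, (∀ x, |b x| ≤ M) →
        Tendsto (fun k ↦ ∫ x in Ω, b x * u k x) 𝒰 (𝓝 (∫ x in Ω, b x * w x)) := by
  have hfin : IsFiniteMeasure (volume.restrict Ω) := ⟨by simpa using hΩb.measure_lt_top⟩
  have hD : ∀ k, IsDerivMeasure (u k) (bvDeriv (u k)) := fun k ↦ isDerivMeasure_bvDeriv (hu k).1
  have := fun k ↦ (hD k).1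
  obtain ⟨D, hDf, hDlim⟩ := exists_vectorMeasure_tendsto 𝒰 hT
  obtain ⟨g, hg, hglim⟩ := exists_weak_limit (μ := volume.restrict Ω) 𝒰
    (fun k ↦ (hu k).1.1.restrict) (C := C)
    (fun k ↦ (setIntegral_le_integral (hu k).1.1.abs (ae_of_all _ fun _ ↦ abs_nonneg _)).trans
      (hC k))
    fun ε hε ↦ by
      obtain ⟨δ, hδ, h⟩ := exists_forall_abs_setIntegral_le (n := n) C T hε
      refine ⟨δ, hδ, fun k A hA hAδ ↦ ?_⟩
      rw [Measure.restrict_restrict hA]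
      rw [Measure.restrict_apply hA] at hAδ
      exact h _ (hu k).1 (hC k) (hT k) _ (hA.inter hΩ.measurableSet) hAδ
  let w : E → ℝ := Ω.indicator g
  have hw : Integrable w := (integrable_indicator_iff hΩ.measurableSet).2 hg
  have hw0 : ∀ x ∉ Ω, w x = 0 := fun x hx ↦ indicator_of_notMem hx g
  have hblim : ∀ b : E → ℝ, Measurable b → ∀ M : ℝ, (∀ x, |b x| ≤ M) →
      Tendsto (fun k ↦ ∫ x in Ω, b x * u k x) 𝒰 (𝓝 (∫ x in Ω, b x * w x)) := fun b hb M hM ↦ by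
    have : ∫ x in Ω, b x * w x = ∫ x in Ω, b x * g x :=
      setIntegral_congr_fun hΩ.measurableSet fun x hx ↦ by simp [w, hx]
    rw [this]
    exact hglim b hb M hM
  -- Tested against a fixed `v`, the left side is an integral of `u k` over `Ω` against the bounded
  -- function `⟪v, ∇φ⟫`, so weak convergence suffices; the right side converges vaguely.
  have hwD : IsDerivMeasure w D := by
    refine ⟨hDf, fun φ hφ hc ↦ ext_inner_left ℝ fun v ↦ ?_⟩
    have hcd : Continuous (fderiv ℝ φ) := hφ.continuous_fderiv (by norm_num)
    have hgc : Continuous (gradient φ) :=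
      (InnerProductSpace.toDual ℝ E).symm.continuous.comp hcd
    obtain ⟨B, hB⟩ := (hc.fderiv (𝕜 := ℝ)).exists_bound_of_continuous hcd
    have hB' : ∀ x, ‖gradient φ x‖ ≤ B := fun x ↦
      ((InnerProductSpace.toDual ℝ E).symm.norm_map _).trans_le (hB x)
    have hinner : ∀ f : E → ℝ, Integrable f → (∀ᵐ x, x ∉ Ω → f x = 0) →
        ⟪v, ∫ x, f x • gradient φ x⟫ = ∫ x in Ω, ⟪v, gradient φ x⟫ * f x := fun f hf hf0 ↦ by
      have hi : Integrable fun x ↦ f x • gradient φ x :=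
        hf.smul_bdd B hgc.aestronglyMeasurable (ae_of_all _ hB')
      rw [← integral_inner hi, setIntegral_eq_integral_of_ae_compl_eq_zero]
      · simp_rw [inner_smul_right, mul_comm]
      · filter_upwards [hf0] with x hx hxΩ
        rw [hx hxΩ, mul_zero]
    rw [hinner w hw (ae_of_all _ hw0)]
    have hlim := hblim (fun x ↦ ⟪v, gradient φ x⟫) (continuous_const.inner hgc).measurable
      (‖v‖ * B) fun x ↦ (abs_real_inner_le_norm _ _).trans
        (mul_le_mul_of_nonneg_left (hB' x) (norm_nonneg _))
    refine tendsto_nhds_unique hlim ?_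
    refine ((tendsto_const_nhds (x := v)).inner (hDlim φ hφ.continuous hc).neg).congr fun k ↦ ?_
    rw [← (hD k).2 φ hφ hc, hinner _ (hu k).1.1 (hu k).2]
  have hwA : w ∈ A0 Ω := ⟨⟨hw, D, hwD⟩, ae_of_all _ hw0⟩
  refine ⟨w, hwA, ?_, hblim⟩
  rw [(isDerivMeasure_bvDeriv hwA.1).unique hwD]
  exact hDlim

lemma zero_mem_A0 : (0 : E → ℝ) ∈ A0 Ω := by
  refine ⟨⟨integrable_zero _ _ _, 0, ?_, fun φ _ _ ↦ ?_⟩, ae_of_all _ fun _ _ ↦ rfl⟩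
  · rw [VectorMeasure.variation_zero]; infer_instance
  · simp

/-- A bounded set is displaced by a sufficiently large translation. -/
lemma exists_forall_sub_notMem (hn : 1 ≤ n) (hΩb : Bornology.IsBounded Ω) :
    ∃ v : E, 0 < ‖v‖ ∧ ∀ x ∈ Ω, x - v ∉ Ω := by
  obtain ⟨r, hr, hΩr⟩ := hΩb.subset_ball_lt 0 0
  obtain ⟨v, hv⟩ : ∃ v : E, ‖v‖ = 2 * r :=
    ⟨EuclideanSpace.single ⟨0, hn⟩ (2 * r), by simp [abs_of_pos hr]⟩
  refine ⟨v, by rw [hv]; positivity, fun x hx hxv ↦ ?_⟩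
  have h1 := mem_ball_zero_iff.1 (hΩr hx)
  have h2 := mem_ball_zero_iff.1 (hΩr hxv)
  have h3 := norm_sub_le x (x - v)
  rw [_root_.sub_sub_cancel, hv] at h3
  linarith

/-- Extension of the coefficient by an upper bound. -/
lemma lowerSemicontinuous_ite {X : Type*} [TopologicalSpace X] {s : Set X} (hs : IsClosed s)
    [DecidablePred (· ∈ s)] {a : X → ℝ} (ha : LowerSemicontinuousOn a s) {M : ℝ}
    (hM : ∀ x ∈ s, a x ≤ M) : LowerSemicontinuous fun x ↦ if x ∈ s then a x else M := by
  intro x c hc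
  by_cases hx : x ∈ s
  · simp only [hx, if_true] at hc
    filter_upwards [eventually_nhdsWithin_iff.1 (ha x hx c hc)] with y hy
    split_ifs with h
    exacts [hy h, hc.trans_le (hM x hx)]
  · simp only [hx, if_false] at hc
    filter_upwards [hs.isOpen_compl.mem_nhds hx] with y hy
    rw [if_neg hy]; exact hc

/-- Lower semicontinuity of the total variation of `Du + F dx`, weighted with a lower semicontinuous
function. -/
theorem integral_variation_shiftedDeriv_le {ι : Type*} (𝒰 : Ultrafilter ι) {F : E → E}
    (hF : IntegrableOn F Ω) {u : ι → E → ℝ} (hu : ∀ k, IsBV (u k)) {T : ℝ}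
    (hT : ∀ k, (shiftedDeriv Ω F (u k)).variation.real univ ≤ T) {w : E → ℝ} (hw : IsBV w)
    (hlim : ∀ φ : E → ℝ, Continuous φ → HasCompactSupport φ →
      Tendsto (fun k ↦ (bvDeriv (u k)).integral φ (ContinuousLinearMap.lsmul ℝ ℝ)) 𝒰
        (𝓝 ((bvDeriv w).integral φ (ContinuousLinearMap.lsmul ℝ ℝ))))
    {b : E → ℝ} (hb : LowerSemicontinuous b) (hb0 : ∀ x, 0 ≤ b x) {M : ℝ} (hbM : ∀ x, b x ≤ M)
    {c : ℝ} (hc : Tendsto (fun k ↦ ∫ x, b x ∂(shiftedDeriv Ω F (u k)).variation) 𝒰 (𝓝 c)) :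
    ∫ x, b x ∂(shiftedDeriv Ω F w).variation ≤ c := by
  have := fun k ↦ isFiniteMeasure_variation_shiftedDeriv hF (hu k)
  have := isFiniteMeasure_variation_shiftedDeriv hF hw
  have := fun k ↦ (isDerivMeasure_bvDeriv (hu k)).1
  have := (isDerivMeasure_bvDeriv hw).1
  have := isFiniteMeasure_variation_withDensityᵥ hF
  obtain ⟨lam, hlamf, hlam⟩ := exists_measure_tendsto 𝒰 hT
  have hsum : ∀ {f : E → ℝ} {φ : E → ℝ}, IsBV f → Continuous φ → HasCompactSupport φ →
      (shiftedDeriv Ω F f).integral φ (ContinuousLinearMap.lsmul ℝ ℝ) =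
        (bvDeriv f).integral φ (ContinuousLinearMap.lsmul ℝ ℝ) +
        ((volume.restrict Ω).withDensityᵥ F).integral φ (ContinuousLinearMap.lsmul ℝ ℝ) :=
    fun hf hφ hφc ↦ by
      have := (isDerivMeasure_bvDeriv hf).1
      exact VectorMeasure.integral_add_vectorMeasure (integrable_lsmul_of_hasCompactSupport hφ hφc)
        (integrable_lsmul_of_hasCompactSupport hφ hφc)
  -- The vague limit of the variations may exceed the variation of the limit because of
  -- cancellation; this inequality is all that semicontinuity needs.
  have hle : (shiftedDeriv Ω F w).variation ≤ lam := by
    refine variation_le_of_integral_le fun φ hφ hφc hφ0 ↦ ?_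
    have h1 := ((hlim φ hφ hφc).add_const
      (((volume.restrict Ω).withDensityᵥ F).integral φ (ContinuousLinearMap.lsmul ℝ ℝ))).norm
    rw [← hsum hw hφ hφc] at h1
    refine le_of_tendsto_of_tendsto' h1 (hlam φ hφ hφc) fun k ↦ ?_
    rw [← hsum (hu k) hφ hφc]
    refine VectorMeasure.norm_integral_le_integral_norm.trans ?_
    refine (mul_le_of_le_one_left (integral_nonneg fun _ ↦ norm_nonneg _)
      ContinuousLinearMap.opNorm_lsmul_le).trans (le_of_eq ?_)
    congr 1; ext x
    exact abs_of_nonneg (hφ0 x)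
  have hbi : Integrable b lam := Integrable.of_bound hb.measurable.aestronglyMeasurable M
    (ae_of_all _ fun x ↦ by rw [Real.norm_eq_abs, abs_of_nonneg (hb0 x)]; exact hbM x)
  exact (integral_mono_measure hle (ae_of_all _ hb0) hbi).trans
    (integral_le_of_tendsto 𝒰 hlam hb hb0 hbM hc)

/-- Existence of minimizers for integrands extended to the whole space. -/
theorem exists_forall_energy_le (hΩ : IsOpen Ω) (hΩb : Bornology.IsBounded Ω) {v : E}
    (hv : ∀ x ∈ Ω, x - v ∉ Ω) {b : E → ℝ} (hb : LowerSemicontinuous b) {α M : ℝ} (hα : 0 < α)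
    (hbα : ∀ x, α ≤ b x) (hbM : ∀ x, b x ≤ M) {F : E → E} (hF : IntegrableOn F Ω)
    {H : E → ℝ} (hH : Measurable H) {h : ℝ} (hHh : ∀ x, |H x| ≤ h) (hh : h * ‖v‖ < α) :
    ∃ u ∈ A0 Ω, ∀ w ∈ A0 Ω,
      ∫ x, b x ∂(shiftedDeriv Ω F u).variation + ∫ x in Ω, H x * u x ≤
      ∫ x, b x ∂(shiftedDeriv Ω F w).variation + ∫ x in Ω, H x * w x := by
  let J : (E → ℝ) → ℝ := fun u ↦
    ∫ x, b x ∂(shiftedDeriv Ω F u).variation + ∫ x in Ω, H x * u x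
  have hh0 : 0 ≤ h := (abs_nonneg _).trans (hHh 0)
  have := isFiniteMeasure_variation_withDensityᵥ hF
  set N := ((volume.restrict Ω).withDensityᵥ F).variation.real univ with hN
  have hN0 : 0 ≤ N := measureReal_nonneg
  have hpoin : ∀ u ∈ A0 Ω, ∫ x, |u x| ≤ ‖v‖ * (bvDeriv u).variation.real univ := fun u hu ↦ by
    have hD := isDerivMeasure_bvDeriv hu.1
    have := hD.1
    obtain ⟨p, hp, -, hpn⟩ := hD.exists_density hu.1.1
    rw [← hpn]
    exact hp.integral_abs_le hΩ.measurableSet hu.2 hv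
  have hle1 : ∀ u ∈ A0 Ω, (bvDeriv u).variation.real univ ≤
      (shiftedDeriv Ω F u).variation.real univ + N := fun u hu ↦ by
    have := isFiniteMeasure_variation_shiftedDeriv hF hu.1
    have h1 : bvDeriv u = shiftedDeriv Ω F u - (volume.restrict Ω).withDensityᵥ F :=
      (add_sub_cancel_right _ _).symm
    have h2 := VectorMeasure.variation_sub_le (μ := shiftedDeriv Ω F u)
      (ν := (volume.restrict Ω).withDensityᵥ F) univ
    rw [← h1, Measure.add_apply] at h2
    rw [hN, Measure.real, Measure.real, Measure.real,
      ← ENNReal.toReal_add (measure_ne_top _ _) (measure_ne_top _ _)]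
    exact ENNReal.toReal_mono (by finiteness) h2
  have hle2 : ∀ u ∈ A0 Ω, (shiftedDeriv Ω F u).variation.real univ ≤
      (bvDeriv u).variation.real univ + N := fun u hu ↦ by
    have := (isDerivMeasure_bvDeriv hu.1).1
    have h2 := VectorMeasure.variation_add_le (μ := bvDeriv u)
      (ν := (volume.restrict Ω).withDensityᵥ F) univ
    rw [Measure.add_apply] at h2
    rw [hN, Measure.real, Measure.real, Measure.real,
      ← ENNReal.toReal_add (measure_ne_top _ _) (measure_ne_top _ _)]
    exact ENNReal.toReal_mono (by finiteness) h2
  -- The weighted variation is at least `α (|Du| - N)`, and by the Poincaré inequality the `H`-term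
  -- is at least `-h ‖v‖ |Du|`.
  have hcoer : ∀ u ∈ A0 Ω, (α - h * ‖v‖) * (bvDeriv u).variation.real univ - α * N ≤ J u :=
    fun u hu ↦ by
    have := isFiniteMeasure_variation_shiftedDeriv hF hu.1
    have h1 : α * (shiftedDeriv Ω F u).variation.real univ ≤
        ∫ x, b x ∂(shiftedDeriv Ω F u).variation := by
      have hbi : Integrable b (shiftedDeriv Ω F u).variation :=
        Integrable.of_bound hb.measurable.aestronglyMeasurable M
          (ae_of_all _ fun x ↦ by
            rw [Real.norm_eq_abs, abs_of_nonneg (hα.le.trans (hbα x))]; exact hbM x)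
      have := integral_mono (integrable_const α) hbi hbα
      rwa [integral_const, smul_eq_mul, mul_comm] at this
    have h2 : |∫ x in Ω, H x * u x| ≤ h * ∫ x, |u x| := by
      rw [← integral_const_mul, ← Real.norm_eq_abs]
      refine (norm_integral_le_of_norm_le (hu.1.1.abs.const_mul h).restrict
        (ae_of_all _ fun x ↦ ?_)).trans (setIntegral_le_integral (hu.1.1.abs.const_mul h)
          (ae_of_all _ fun x ↦ mul_nonneg hh0 (abs_nonneg _)))
      rw [norm_mul]
      exact mul_le_mul_of_nonneg_right (hHh x) (abs_nonneg _)
    have h3 := mul_le_mul_of_nonneg_left (hpoin u hu) hh0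
    have h4 := mul_le_mul_of_nonneg_left (hle1 u hu) hα.le
    have h5 := (abs_le.1 h2).1
    simp only [J]
    nlinarith
  have hbdd : BddBelow (J '' A0 Ω) := ⟨-(α * N), by
    rintro _ ⟨u, hu, rfl⟩
    have h1 := hcoer u hu
    have h2 : 0 ≤ (α - h * ‖v‖) * (bvDeriv u).variation.real univ :=
      mul_nonneg (sub_pos.2 hh).le measureReal_nonneg
    linarith⟩
  obtain ⟨s, hs, hslim, hsmem⟩ := exists_seq_tendsto_sInf ⟨_, mem_image_of_mem J zero_mem_A0⟩ hbdd
  choose u hu hus using hsmem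
  -- The minimizing values decrease, so `s 0` bounds them all.
  have hT : ∀ k, (bvDeriv (u k)).variation.real univ ≤ (s 0 + α * N) / (α - h * ‖v‖) := fun k ↦ by
    rw [le_div_iff₀ (sub_pos.2 hh), mul_comm]
    have h1 := hcoer _ (hu k)
    rw [hus k] at h1
    linarith [hs (Nat.zero_le k)]
  obtain ⟨w, hw, hwD, hwH⟩ := exists_limit_mem_A0 (hyperfilter ℕ) hΩ hΩb hu
    (fun k ↦ (hpoin _ (hu k)).trans (mul_le_mul_of_nonneg_left (hT k) (norm_nonneg v))) hT
  have hJ : Tendsto (fun k ↦ J (u k)) (hyperfilter ℕ) (𝓝 (sInf (J '' A0 Ω))) := by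
    simp_rw [hus]
    exact hslim.mono_left Nat.hyperfilter_le_atTop
  -- The `H`-term converges, hence so does the variation part separately, and lower semicontinuity
  -- applies to it alone.
  have hlim : Tendsto (fun k ↦ ∫ x, b x ∂(shiftedDeriv Ω F (u k)).variation) (hyperfilter ℕ)
      (𝓝 (sInf (J '' A0 Ω) - ∫ x in Ω, H x * w x)) :=
    (hJ.sub (hwH H hH h hHh)).congr fun k ↦ add_sub_cancel_right _ _
  have hfinal := integral_variation_shiftedDeriv_le (hyperfilter ℕ) hF (fun k ↦ (hu k).1)
    (fun k ↦ (hle2 _ (hu k)).trans (add_le_add_left (hT k) N)) hw.1 hwD hb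
    (fun x ↦ hα.le.trans (hbα x)) hbM hlim
  refine ⟨w, hw, fun z hz ↦ ?_⟩
  have := csInf_le hbdd (mem_image_of_mem J hz)
  change _ ≤ J z
  linarith

end Existence

end RelaxedDirichlet

end

theorem mainTheorem9 (n : ℕ) (hn : 1 ≤ n) (Ω : Set (EuclideanSpace ℝ (Fin n)))
    (hΩ : IsOpen Ω) (hΩb : Bornology.IsBounded Ω)
    (hΩL : RelaxedDirichlet.HasLipschitzBoundary Ω) :
    ∃ C : ℝ, 0 < C ∧
      ∀ (a : EuclideanSpace ℝ (Fin n) → ℝ) (α M : ℝ), 0 < α →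
        LowerSemicontinuousOn a (closure Ω) →
        (∀ x ∈ closure Ω, α ≤ a x ∧ a x ≤ M) →
      ∀ F : EuclideanSpace ℝ (Fin n) → EuclideanSpace ℝ (Fin n), IntegrableOn F Ω →
      ∀ H : EuclideanSpace ℝ (Fin n) → ℝ, AEStronglyMeasurable H (volume.restrict Ω) →
        eLpNorm H ⊤ (volume.restrict Ω) < ENNReal.ofReal (C * α) →
        ∃ u ∈ RelaxedDirichlet.A0 Ω,
          IsMinOn (RelaxedDirichlet.relaxedEnergy Ω a F H) (RelaxedDirichlet.A0 Ω) u := by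
  classical
  obtain ⟨v, hv0, hv⟩ := RelaxedDirichlet.exists_forall_sub_notMem hn hΩb
  -- The inverse Poincaré constant: `‖H‖_∞ < C α` becomes `h * ‖v‖ < α`, and `v` depends only on
  -- `Ω`.
  refine ⟨‖v‖⁻¹, inv_pos.2 hv0, fun a α M hα ha haM F hF H hH hHα ↦ ?_⟩
  -- An upper bound as outer value keeps lower semicontinuity across `∂Ω`. The maximum with `α`
  -- covers empty `Ω`, where `α ≤ M` is not implied.
  let b : EuclideanSpace ℝ (Fin n) → ℝ := fun x ↦ if x ∈ closure Ω then a x else max M α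
  have hbM : ∀ x, b x ≤ max M α := fun x ↦ by
    by_cases hx : x ∈ closure Ω
    · simpa only [b, hx, if_true] using (haM x hx).2.trans (le_max_left _ _)
    · simp only [b, hx, if_false, le_refl]
  have hbα : ∀ x, α ≤ b x := fun x ↦ by
    by_cases hx : x ∈ closure Ω
    · simpa only [b, hx, if_true] using (haM x hx).1
    · simpa only [b, hx, if_false] using le_max_right _ _
  have hb : LowerSemicontinuous b := RelaxedDirichlet.lowerSemicontinuous_ite isClosed_closure ha
    fun x hx ↦ (haM x hx).2.trans (le_max_left _ _)
  set h := (eLpNorm H ⊤ (volume.restrict Ω)).toReal with hh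
  have hh0 : 0 ≤ h := ENNReal.toReal_nonneg
  have hhα : h * ‖v‖ < α := by
    have := ENNReal.toReal_lt_of_lt_ofReal hHα
    rw [← hh, inv_mul_eq_div, lt_div_iff₀ hv0] at this
    exact this
  have hHh : ∀ᵐ x ∂(volume.restrict Ω), |H x| ≤ h := by
    rw [eLpNorm_exponent_top] at hHα hh
    filter_upwards [ae_le_eLpNormEssSup (f := H) (μ := volume.restrict Ω)] with x hx
    have := ENNReal.toReal_mono hHα.ne_top hx
    rwa [toReal_enorm, ← hh] at this
  -- A Borel representative of `H`, truncated so that the essential bound holds everywhere.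
  let H' : EuclideanSpace ℝ (Fin n) → ℝ := fun x ↦ max (-h) (min h (hH.mk H x))
  have hH'm : Measurable H' :=
    measurable_const.max (measurable_const.min hH.stronglyMeasurable_mk.measurable)
  have hH'h : ∀ x, |H' x| ≤ h := fun x ↦
    abs_le.2 ⟨le_max_left _ _, max_le (by linarith) (min_le_left _ _)⟩
  have hHH' : H =ᵐ[volume.restrict Ω] H' := by
    filter_upwards [hHh, hH.ae_eq_mk] with x hx hx'
    simp only [H']
    rw [← hx', min_eq_right (abs_le.1 hx).2, max_eq_right (abs_le.1 hx).1]
  obtain ⟨u, hu, hmin⟩ := RelaxedDirichlet.exists_forall_energy_le hΩ hΩb hv hb hα hbα hbM hF hH'm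
    hH'h hhα
  have henergy : ∀ w ∈ RelaxedDirichlet.A0 Ω, RelaxedDirichlet.relaxedEnergy Ω a F H w =
      ∫ x, b x ∂(RelaxedDirichlet.shiftedDeriv Ω F w).variation + ∫ x in Ω, H' x * w x :=
    fun w hw ↦ by
    rw [RelaxedDirichlet.relaxedEnergy_eq hΩ hΩb hΩL hw hF hb.measurable (M := max M α)
      (fun x ↦ abs_le.2 ⟨by linarith [hbα x, le_max_right M α], hbM x⟩)
      (fun x hx ↦ (if_pos hx).symm) H]
    congr 1
    refine integral_congr_ae ?_
    filter_upwards [hHH'] with x hx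
    rw [hx]
  refine ⟨u, hu, isMinOn_iff.2 fun w hw ↦ ?_⟩
  rw [henergy u hu, henergy w hw]
  exact hmin w hw
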